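/- For nonnegative integers $a,b,c$, an $(a,b,c)$ hexagon is the hexagon with all angles equal to $120$ degrees whose sides have lengths $a,b,c,a,b,c$ in clockwise order, the first side of length $b$ being the horizontal top side, subdivided into equilateral triangles of unit side by lines parallel to the sides. A lozenge is the union of two of these unit triangles that share a side, and a tiling of the hexagon is a set of lozenges that covers each of its unit triangles exactly once. A vertical lozenge is one whose two triangles share a horizontal side; it is at the center of the hexagon if the midpoint of that side is the center of the hexagon. Write $V_n=1!\,2!\cdots n!$ (with $V_0=V_{-1}=1$) and $(a)_j=a(a+1)\cdots(a+j-1)$ (with $(a)_0=1$). (i) For all integers $m\ge 1$ and $n\ge 0$, the number of tilings of a $(2m-1,2n,2m-1)$ hexagon with a vertical lozenge at the center is \[\frac{V_{4m+2n-3}\,V_{2n-1}\,V_{2m-2}^2}{(2m+2n-1)\,V_{2m+2n-2}^2\,V_{4m-3}} \sum_{j=0}^{m-1}\frac{(\frac12)_j^2\,(\frac54)_j\,(1-m-n)_j\,(m+n)_j}{(1)_j^2\,(\frac14)_j\,(\frac12+m+n)_j\,(\frac32-m-n)_j}.\] (ii) For all integers $m\ge 0$ and $n\ge 1$, the number of tilings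 of a $(2m,2n-1,2m)$ hexagon with a vertical lozenge at the center is \[\frac{V_{4m+2n-2}\,V_{2n-2}\,V_{2m-1}^2}{(2m+2n-1)\,V_{2m+2n-2}^2\,V_{4m-1}} \sum_{j=0}^{m-1}\frac{(\frac12)_j^2\,(\frac54)_j\,(1-m-n)_j\,(m+n)_j}{(1)_j^2\,(\frac14)_j\,(\frac12+m+n)_j\,(\frac32-m-n)_j}.\] (For $m=0$ the sum is empty, hence $0$.) -/

import Mathlib

/-- The equilateral triangles of unit side cut out by the triangular lattice. The pair `(x, y)` of
integers stands for the lattice point `x • (1, 0) + y • (1/2, √3/2)` of the plane.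
`up x y` is the upward pointing triangle on the horizontal base from `(x, y)` to `(x + 1, y)`;
`down x y` is the downward pointing triangle that hangs from the horizontal side
from `(x, y + 1)` to `(x + 1, y + 1)`. -/
inductive UnitTriangle : Type
  | up (x y : ℤ) : UnitTriangle
  | down (x y : ℤ) : UnitTriangle
  deriving DecidableEq

/-- The three corners of a unit triangle. -/
def UnitTriangle.vertices : UnitTriangle → Finset (ℤ × ℤ)
  | .up x y => {(x, y), (x + 1, y), (x, y + 1)}
  | .down x y => {(x + 1, y), (x, y + 1), (x + 1, y + 1)}

/-- The lattice points of the `(a, b, c)` hexagon. All angles are 120 degrees, and in clockwise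
order the sides have lengths `a, b, c, a, b, c`, with the first side of length `b` at the top.
In lattice coordinates its corners are, counterclockwise from the left end of the bottom side,
`(0, 0)`, `(b, 0)`, `(b, a)`, `(b - c, a + c)`, `(-c, a + c)`, `(-c, c)`. -/
def hexagonPoints (a b c : ℕ) : Set (ℤ × ℤ) :=
  {p | 0 ≤ p.2 ∧ p.2 ≤ a + c ∧ -(c : ℤ) ≤ p.1 ∧ p.1 ≤ b ∧ 0 ≤ p.1 + p.2 ∧ p.1 + p.2 ≤ a + b}

/-- The unit triangles into which the `(a, b, c)` hexagon is subdivided. -/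
def hexagon (a b c : ℕ) : Set UnitTriangle :=
  {t | ∀ p ∈ t.vertices, p ∈ hexagonPoints a b c}

/-- A lozenge consists of two distinct unit triangles that share a side. -/
def IsLozenge (L : Finset UnitTriangle) : Prop :=
  ∃ s t : UnitTriangle, s ≠ t ∧ (s.vertices ∩ t.vertices).card = 2 ∧ L = {s, t}

/-- `T` is a tiling by lozenges of the region formed by the unit triangles in `R`: its members are
lozenges inside `R`, and they cover every unit triangle of `R` exactly once. -/
def IsLozengeTiling (R : Set UnitTriangle) (T : Finset (Finset UnitTriangle)) : Prop :=
  (∀ L ∈ T, IsLozenge L ∧ (L : Set UnitTriangle) ⊆ R) ∧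
    ∀ t ∈ R, ∃! L : Finset UnitTriangle, L ∈ T ∧ t ∈ L

/-- The vertical lozenge whose two triangles share the horizontal side from `(x, y)` to
`(x + 1, y)`. Its center is the midpoint of that side. -/
def verticalLozenge (x y : ℤ) : Finset UnitTriangle :=
  {UnitTriangle.up x y, UnitTriangle.down x (y - 1)}

/-- `T` contains a vertical lozenge whose center `(x + 1/2, y)` is the center
`((b - c)/2, (a + c)/2)` of the `(a, b, c)` hexagon. -/
def HasCentralVerticalLozenge (a b c : ℕ) (T : Finset (Finset UnitTriangle)) : Prop :=
  ∃ x y : ℤ, 2 * x + 1 = (b : ℤ) - c ∧ 2 * y = (a : ℤ) + c ∧ verticalLozenge x y ∈ T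

/-- The tilings of the `(a, b, c)` hexagon that have a vertical lozenge at the center. -/
def centralTilings (a b c : ℕ) : Set (Finset (Finset UnitTriangle)) :=
  {T | IsLozengeTiling (hexagon a b c) T ∧ HasCentralVerticalLozenge a b c T}

/-- A hexagon has finitely many unit triangles. -/
theorem hexagon_finite (a b c : ℕ) : (hexagon a b c).Finite := by
  let S : Finset (ℤ × ℤ) := Finset.Icc (-(c : ℤ) - 1) b ×ˢ Finset.Icc (-1) ((a : ℤ) + c)
  refine ((S.image (fun p => UnitTriangle.up p.1 p.2)) ∪
    (S.image (fun p => UnitTriangle.down p.1 p.2))).finite_toSet.subset ?_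
  rintro (⟨x, y⟩ | ⟨x, y⟩) h
  · have h1 := h (x, y) (by simp [UnitTriangle.vertices])
    simp only [hexagonPoints, Set.mem_ofPred_eq] at h1
    simp [S]
    omega
  · have h1 := h (x + 1, y) (by simp [UnitTriangle.vertices])
    simp only [hexagonPoints, Set.mem_ofPred_eq] at h1
    simp [S]
    omega

/-- There are finitely many such tilings, so that their `Set.ncard` is their number. -/
theorem centralTilings_finite (a b c : ℕ) : (centralTilings a b c).Finite := by
  refine ((hexagon_finite a b c).toFinset.powerset.powerset).finite_toSet.subset ?_
  rintro T ⟨⟨h, -⟩, -⟩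
  simp only [Finset.coe_powerset, Set.mem_preimage, Set.mem_powerset_iff]
  intro L hL
  simpa using (h L hL).2

/-- The rising factorial `(a)_j = a (a + 1) ⋯ (a + j - 1)`. -/
noncomputable def risingFactorial (a : ℚ) (j : ℕ) : ℚ :=
  (ascPochhammer ℚ j).eval a

/-- The sum over `0 ≤ j ≤ m - 1` of
`(1/2)_j² (5/4)_j (1-m-n)_j (m+n)_j / ((1)_j² (1/4)_j (1/2+m+n)_j (3/2-m-n)_j)`. -/
noncomputable def wellPoisedSum (m n : ℕ) : ℚ :=
  ∑ j ∈ Finset.range m,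
    (risingFactorial (1 / 2) j ^ 2 * risingFactorial (5 / 4) j *
        risingFactorial (1 - m - n) j * risingFactorial (m + n) j) /
      (risingFactorial 1 j ^ 2 * risingFactorial (1 / 4) j *
        risingFactorial (1 / 2 + m + n) j * risingFactorial (3 / 2 - m - n) j)

/-! Cut the hexagon along its horizontal axis. In the strip between two consecutive horizontal
lines, the vertical lozenges on these lines force all other lozenges, and they can be prescribed
exactly when their positions interlace (`strip_tiled_iff`). Hence the line at height j ≤ a carries j
vertical lozenges, each half is an interlacing chain that ends in the set S of positions on the
axis, and a tiling is a pair of chains with the same S, an a-element subset of the a + b integers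
from -a to b - 1. Summing Vandermonde determinants over all rows that interlace a given row yields,
up to a factorial, the Vandermonde determinant of that row (`sum_det_vandermonde_interlacing`). So
each S accounts for (Δ(S) / (0! 1! ⋯ (a-1)!))² tilings.

It remains to sum Δ(S)² over the S that contain the midpoint c
(`sum_strictMono_det_vandermonde_sq`). By Cauchy–Binet, the sum of Δ(S)² ∏ w(x) over all S, with x
running through S, is a Gram determinant. In the basis of the Gram polynomials p_k, orthogonal for w
= 1 with squared norms h_k, the weight w = 1 - t·[x = c] perturbs a diagonal matrix by one of rank
one, and the determinant is ∏ h_k · (1 - t ∑ p_k(0)² / h_k). At t = 0 every S counts, at t = 1 only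
those avoiding c; the difference is the required sum.

The three-term recurrence makes everything explicit. The product of the h_k gives the
superfactorials. The values p_k(0) vanish for odd k, and for k = 2j the ratio of consecutive terms
p_k(0)² / h_k is the term ratio of the well-poised sum. -/

/-! ### Gram polynomials: recurrence, orthogonality, values at the centre -/

/-- The coefficient in the three-term recurrence of the Gram polynomials. -/
def gramCoeff (N : ℚ) (k : ℕ) : ℚ := (k : ℚ) ^ 2 * (N ^ 2 - (k : ℚ) ^ 2) / (4 * (4 * (k : ℚ) ^ 2 - 1))

open Polynomial in
/-- The monic discrete Chebyshev (Gram) polynomials, orthogonal with respect to the uniform weight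
on `N` consecutive points centred at the origin. -/
noncomputable def gramPoly (N : ℚ) : ℕ → ℚ[X]
  | 0 => 1
  | 1 => X
  | (k + 2) => X * gramPoly N (k + 1) - C (gramCoeff N (k + 1)) * gramPoly N k

open Polynomial in
/-- The monic orthogonal polynomials whose products with `X ^ 2 - N ^ 2 / 4` have the Gram
polynomials as central differences, up to a factor. -/
noncomputable def gramPolyAux (N : ℚ) : ℕ → ℚ[X]
  | 0 => 1
  | 1 => X
  | (k + 2) => X * gramPolyAux N (k + 1) -
      C ((k + 1 : ℚ) * (k + 3) * (N ^ 2 - (k + 2 : ℚ) ^ 2) / (4 * ((2 * k + 3) * (2 * k + 5)))) *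
        gramPolyAux N k

section
open Polynomial

lemma gramPoly_succ_succ (N : ℚ) (k : ℕ) :
    gramPoly N (k + 2) = X * gramPoly N (k + 1) - C (gramCoeff N (k + 1)) * gramPoly N k := by
  rw [gramPoly]

lemma gramPoly_monic_natDegree (N : ℚ) (k : ℕ) :
    (gramPoly N k).Monic ∧ (gramPoly N k).natDegree = k := by
  suffices h : ∀ k, ((gramPoly N k).Monic ∧ (gramPoly N k).natDegree = k) ∧
      ((gramPoly N (k + 1)).Monic ∧ (gramPoly N (k + 1)).natDegree = k + 1) from (h k).1
  intro k
  induction k with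
  | zero => simp [gramPoly, monic_X]
  | succ k ih =>
    obtain ⟨⟨h1, d1⟩, h2, d2⟩ := ih
    refine ⟨⟨h2, d2⟩, ?_⟩
    have hm : (X * gramPoly N (k + 1)).Monic := monic_X.mul h2
    have hd : (X * gramPoly N (k + 1)).natDegree = k + 2 := by
      rw [monic_X.natDegree_mul h2, natDegree_X, d2]; ring
    have hlt : (C (gramCoeff N (k + 1)) * gramPoly N k).degree < (X * gramPoly N (k + 1)).degree := by
      rw [degree_eq_natDegree hm.ne_zero, hd]
      rw [← smul_eq_C_mul]
      refine lt_of_le_of_lt (degree_smul_le _ _) ?_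
      rw [degree_eq_natDegree h1.ne_zero, d1]
      exact_mod_cast (by omega : k < k + 2)
    rw [gramPoly_succ_succ]
    refine ⟨hm.sub_of_left hlt, ?_⟩
    rw [natDegree_sub_eq_left_of_natDegree_lt, hd]
    rw [hd, ← smul_eq_C_mul]
    exact lt_of_le_of_lt (natDegree_smul_le _ _) (by omega)

/-- Write δ and μ for the central difference and the central mean. Then δ(x f) = x δf + μf and μ(x
f) = x μf + δf / 4, so the recurrence of the auxiliary polynomials carries the two formulas forward
only jointly. The first one exhibits an explicit antidifference of each Gram polynomial of positive
degree. -/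
lemma gramPolyAux_central_difference (N : ℚ) (k : ℕ) (x : ℚ) :
    ((x + 1 / 2) ^ 2 - N ^ 2 / 4) * (gramPolyAux N k).eval (x + 1 / 2) -
        ((x - 1 / 2) ^ 2 - N ^ 2 / 4) * (gramPolyAux N k).eval (x - 1 / 2) =
      (k + 2) * (gramPoly N (k + 1)).eval x ∧
    (((x + 1 / 2) ^ 2 - N ^ 2 / 4) * (gramPolyAux N k).eval (x + 1 / 2) +
        ((x - 1 / 2) ^ 2 - N ^ 2 / 4) * (gramPolyAux N k).eval (x - 1 / 2)) / 2 =
      (gramPoly N (k + 2)).eval x - (k + 1 : ℚ) * (k + 2) * (N ^ 2 - (k + 1 : ℚ) ^ 2) /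
        (4 * ((2 * k + 1) * (2 * k + 3))) * (gramPoly N k).eval x := by
  induction k using Nat.strong_induction_on with
  | _ k ih =>
    match k, ih with
    | 0, _ =>
      simp [gramPoly, gramPolyAux, gramCoeff]
      constructor <;> ring
    | 1, _ =>
      simp [gramPoly, gramPolyAux, gramCoeff]
      constructor <;> ring
    | k + 2, ih =>
      obtain ⟨a1, b1⟩ := ih k (by omega)
      obtain ⟨a2, b2⟩ := ih (k + 1) (by omega)
      have e1 : (gramPoly N (k + 1 + 1 + 1 + 1)).eval x = x * (gramPoly N (k + 3)).eval x -
          gramCoeff N (k + 3) * (gramPoly N (k + 2)).eval x := by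
        rw [gramPoly_succ_succ]; simp
      have e2 : (gramPoly N (k + 1 + 1 + 1)).eval x = x * (gramPoly N (k + 2)).eval x -
          gramCoeff N (k + 2) * (gramPoly N (k + 1)).eval x := by
        rw [gramPoly_succ_succ]; simp
      have e3 : (gramPoly N (k + 1 + 1)).eval x = x * (gramPoly N (k + 1)).eval x -
          gramCoeff N (k + 1) * (gramPoly N k).eval x := by
        rw [gramPoly_succ_succ]; simp
      have h0 : (2 * (k : ℚ) + 1) ≠ 0 := by positivity
      have h1 : (2 * (k : ℚ) + 3) ≠ 0 := by positivity
      have h2 : (2 * (k : ℚ) + 5) ≠ 0 := by positivity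
      have h3 : (2 * (k : ℚ) + 7) ≠ 0 := by positivity
      have g1 : gramCoeff N (k + 1) = (k + 1 : ℚ) ^ 2 * (N ^ 2 - (k + 1 : ℚ) ^ 2) /
          (4 * ((2 * k + 1) * (2 * k + 3))) := by
        simp only [gramCoeff]; push_cast; congr 1; ring
      have g2 : gramCoeff N (k + 2) = (k + 2 : ℚ) ^ 2 * (N ^ 2 - (k + 2 : ℚ) ^ 2) /
          (4 * ((2 * k + 3) * (2 * k + 5))) := by
        simp only [gramCoeff]; push_cast; congr 1; ring
      have g3 : gramCoeff N (k + 3) = (k + 3 : ℚ) ^ 2 * (N ^ 2 - (k + 3 : ℚ) ^ 2) /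
          (4 * ((2 * k + 5) * (2 * k + 7))) := by
        simp only [gramCoeff]; push_cast; congr 1; ring
      have s1 : (k + 2 : ℚ) * (k + 3) * (N ^ 2 - (k + 2 : ℚ) ^ 2) / (4 * ((2 * k + 3) * (2 * k + 5))) +
          (k + 1 : ℚ) * (k + 3) * (N ^ 2 - (k + 2 : ℚ) ^ 2) / (4 * ((2 * k + 3) * (2 * k + 5))) *
            (k + 2) = (k + 3) * gramCoeff N (k + 2) := by
        rw [g2]; field_simp; ring
      have s2 : -((k + 2 : ℚ) * (k + 3) * (N ^ 2 - (k + 2 : ℚ) ^ 2) /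
            (4 * ((2 * k + 3) * (2 * k + 5)))) + (k + 3) / 4 -
          (k + 1 : ℚ) * (k + 3) * (N ^ 2 - (k + 2 : ℚ) ^ 2) / (4 * ((2 * k + 3) * (2 * k + 5))) =
          -gramCoeff N (k + 3) - (k + 3 : ℚ) * (k + 4) * (N ^ 2 - (k + 3 : ℚ) ^ 2) /
            (4 * ((2 * k + 5) * (2 * k + 7))) := by
        rw [g3]; field_simp; ring
      have s3 : (k + 2 : ℚ) * (k + 3) * (N ^ 2 - (k + 2 : ℚ) ^ 2) / (4 * ((2 * k + 3) * (2 * k + 5))) *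
            gramCoeff N (k + 1) =
          (k + 1 : ℚ) * (k + 3) * (N ^ 2 - (k + 2 : ℚ) ^ 2) / (4 * ((2 * k + 3) * (2 * k + 5))) *
          ((k + 1 : ℚ) * (k + 2) * (N ^ 2 - (k + 1 : ℚ) ^ 2) / (4 * ((2 * k + 1) * (2 * k + 3)))) := by
        rw [g1]; field_simp
      push_cast at a2 b2 ⊢
      rw [show 2 * ((k : ℚ) + 1) + 1 = 2 * k + 3 by ring,
        show 2 * ((k : ℚ) + 1) + 3 = 2 * k + 5 by ring, show (k : ℚ) + 1 + 1 = k + 2 by ring,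
        show (k : ℚ) + 1 + 2 = k + 3 by ring] at b2
      rw [show (k : ℚ) + 1 + 2 = k + 3 by ring] at a2
      rw [show 2 * ((k : ℚ) + 2) + 1 = 2 * k + 5 by ring,
        show 2 * ((k : ℚ) + 2) + 3 = 2 * k + 7 by ring, show (k : ℚ) + 2 + 1 = k + 3 by ring,
        show (k : ℚ) + 2 + 2 = k + 4 by ring]
      simp only [gramPolyAux, eval_sub, eval_mul, eval_X, eval_C]
      -- With the fractions as atoms, the induction step is linear in the recurrences and in the
      -- coefficient identities `s1`, `s2`, `s3`.
      generalize (k + 1 : ℚ) * (k + 3) * (N ^ 2 - (k + 2 : ℚ) ^ 2) /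
        (4 * ((2 * k + 3) * (2 * k + 5))) = γ at *
      generalize (k + 1 : ℚ) * (k + 2) * (N ^ 2 - (k + 1 : ℚ) ^ 2) /
        (4 * ((2 * k + 1) * (2 * k + 3))) = ε at *
      generalize (k + 2 : ℚ) * (k + 3) * (N ^ 2 - (k + 2 : ℚ) ^ 2) /
        (4 * ((2 * k + 3) * (2 * k + 5))) = ε' at *
      generalize (k + 3 : ℚ) * (k + 4) * (N ^ 2 - (k + 3 : ℚ) ^ 2) /
        (4 * ((2 * k + 5) * (2 * k + 7))) = ε'' at *
      constructor
      · linear_combination x * a2 + b2 - γ * a1 + (k + 3) * (-e2) - (eval x (gramPoly N (k + 1))) * s1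
      · linear_combination x * b2 + a2 / 4 - γ * b1 - e1 + ε' * e3 +
          (eval x (gramPoly N (k + 2))) * s2 - (eval x (gramPoly N k)) * s3

/-- The sum of the values at the `n` points of the centred lattice interval. -/
noncomputable def centredSum (n : ℕ) (p : ℚ[X]) : ℚ :=
  ∑ i ∈ Finset.range n, p.eval ((i : ℚ) - (n - 1) / 2)

lemma centredSum_sub (n : ℕ) (p q : ℚ[X]) :
    centredSum n (p - q) = centredSum n p - centredSum n q := by
  simp [centredSum, Finset.sum_sub_distrib]

lemma centredSum_C_mul (n : ℕ) (c : ℚ) (p : ℚ[X]) :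
    centredSum n (C c * p) = c * centredSum n p := by
  simp [centredSum, Finset.mul_sum]

lemma centredSum_add (n : ℕ) (p q : ℚ[X]) :
    centredSum n (p + q) = centredSum n p + centredSum n q := by
  simp [centredSum, Finset.sum_add_distrib]

/-- The sum telescopes, and the antidifference has the factor x² - n²/4, which vanishes at both ends
x = ±n/2. -/
lemma centredSum_gramPoly_succ (n k : ℕ) : centredSum n (gramPoly n (k + 1)) = 0 := by
  have hk : (k + 2 : ℚ) ≠ 0 := by positivity
  let F : ℕ → ℚ := fun i => ((i - n / 2 : ℚ) ^ 2 - (n : ℚ) ^ 2 / 4) *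
    (gramPolyAux n k).eval (i - n / 2 : ℚ)
  have h : (k + 2 : ℚ) * centredSum n (gramPoly n (k + 1)) = F n - F 0 := by
    rw [← Finset.sum_range_sub, centredSum, Finset.mul_sum]
    refine Finset.sum_congr rfl fun i _ => ?_
    rw [← (gramPolyAux_central_difference n k _).1]
    simp only [F]
    push_cast
    rw [show (i : ℚ) - (n - 1) / 2 + 1 / 2 = i + 1 - n / 2 by ring,
      show (i : ℚ) - (n - 1) / 2 - 1 / 2 = i - n / 2 by ring]
  have h2 : F n - F 0 = 0 := by
    simp only [F]; push_cast; ring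
  rw [h2] at h
  exact (mul_eq_zero.1 h).resolve_left hk

/-- The squared norm of the Gram polynomial of degree `k`. -/
def gramNorm (n k : ℕ) : ℚ := n * ∏ i ∈ Finset.range k, gramCoeff n (i + 1)

lemma X_mul_gramPoly_succ (N : ℚ) (k : ℕ) :
    X * gramPoly N (k + 1) = gramPoly N (k + 2) + C (gramCoeff N (k + 1)) * gramPoly N k := by
  rw [gramPoly_succ_succ]; ring

/-- One factor X at a time is absorbed by the recurrence, which turns degree k + 1 into degrees k +
2 and k. For i < k the constant is never reached; for i = k exactly one path of descents reaches it
and collects the coefficients in `gramNorm`. -/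
lemma centredSum_X_pow_mul_gramPoly (n i : ℕ) :
    (∀ k, i < k → centredSum n (X ^ i * gramPoly n k) = 0) ∧
      centredSum n (X ^ i * gramPoly n i) = gramNorm n i := by
  induction i with
  | zero =>
    refine ⟨fun k hk => ?_, ?_⟩
    · obtain ⟨k, rfl⟩ := Nat.exists_eq_succ_of_ne_zero hk.ne'
      simpa using centredSum_gramPoly_succ n k
    · simp [gramNorm, gramPoly, centredSum]
  | succ i ih =>
    have step : ∀ k, X ^ (i + 1) * gramPoly (n : ℚ) (k + 1) =
        X ^ i * gramPoly n (k + 2) + C (gramCoeff n (k + 1)) * (X ^ i * gramPoly n k) := by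
      intro k
      rw [pow_succ, mul_assoc, X_mul_gramPoly_succ]; ring
    refine ⟨fun k hk => ?_, ?_⟩
    · obtain ⟨k, rfl⟩ := Nat.exists_eq_succ_of_ne_zero (by omega : k ≠ 0)
      rw [Nat.succ_eq_add_one, step, centredSum_add, centredSum_C_mul, ih.1 _ (by omega),
        ih.1 _ (by omega)]
      simp
    · rw [step, centredSum_add, centredSum_C_mul, ih.1 _ (by omega), ih.2, gramNorm, gramNorm,
        Finset.prod_range_succ]
      ring

lemma centredSum_mul_gramPoly_of_natDegree_lt (n k : ℕ) (p : ℚ[X]) (hp : p.natDegree < k) :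
    centredSum n (p * gramPoly n k) = 0 := by
  have : ∀ q : ℚ[X], centredSum n (p * q) =
      ∑ i ∈ Finset.range (p.natDegree + 1), p.coeff i * centredSum n (X ^ i * q) := by
    intro q
    simp only [centredSum, eval_mul, Finset.mul_sum]
    rw [Finset.sum_comm]
    refine Finset.sum_congr rfl fun j _ => ?_
    rw [eval_eq_sum_range, Finset.sum_mul]
    exact Finset.sum_congr rfl fun i _ => by simp; ring
  rw [this]
  refine Finset.sum_eq_zero fun i hi => ?_
  rw [(centredSum_X_pow_mul_gramPoly n i).1 k (by simp at hi; omega), mul_zero]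

lemma centredSum_gramPoly_mul_gramPoly (n k l : ℕ) :
    centredSum n (gramPoly n k * gramPoly n l) = if k = l then gramNorm n k else 0 := by
  have lt : ∀ k l, k < l → centredSum n (gramPoly n k * gramPoly n l) = 0 := fun k l h =>
    centredSum_mul_gramPoly_of_natDegree_lt n l _ (by rwa [(gramPoly_monic_natDegree _ k).2])
  rcases lt_trichotomy k l with h | rfl | h
  · rw [lt k l h, if_neg h.ne]
  · rw [if_pos rfl, ← (centredSum_X_pow_mul_gramPoly n k).2]
    cases k with
    | zero => simp [gramPoly]
    | succ k =>
      obtain ⟨hm, hd⟩ := gramPoly_monic_natDegree (n : ℚ) (k + 1)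
      -- Being monic, the polynomial differs from its leading power by lower terms, which are
      -- orthogonal to it; so its squared norm is the moment already computed.
      have hlt : (gramPoly (n : ℚ) (k + 1) - X ^ (k + 1)).natDegree < k + 1 := by
        by_contra hcon
        have h1 : (gramPoly (n : ℚ) (k + 1) - X ^ (k + 1)).natDegree = k + 1 :=
          le_antisymm (by
            refine (natDegree_sub_le _ _).trans ?_
            rw [hd, natDegree_X_pow, max_self]) (not_lt.1 hcon)
        have h2 : (gramPoly (n : ℚ) (k + 1) - X ^ (k + 1)).coeff (k + 1) = 0 := by
          have := hm.coeff_natDegree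
          rw [hd] at this
          simp [this]
        have h3 : gramPoly (n : ℚ) (k + 1) - X ^ (k + 1) = 0 := by
          rw [← leadingCoeff_eq_zero, leadingCoeff, h1, h2]
        simp [h3] at h1
      have := centredSum_mul_gramPoly_of_natDegree_lt n (k + 1) _ hlt
      rw [sub_mul, centredSum_sub] at this
      linarith
  · rw [mul_comm, lt l k h, if_neg h.ne']

lemma gramPoly_eval_zero (N : ℚ) (j : ℕ) :
    (gramPoly N (2 * j)).eval 0 = ∏ i ∈ Finset.range j, -gramCoeff N (2 * i + 1) ∧
      (gramPoly N (2 * j + 1)).eval 0 = 0 := by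
  induction j with
  | zero => simp [gramPoly]
  | succ j ih =>
    rw [show 2 * (j + 1) = 2 * j + 2 by ring, show 2 * j + 2 + 1 = 2 * j + 1 + 2 by ring,
      gramPoly_succ_succ, gramPoly_succ_succ, Finset.prod_range_succ, ← ih.1]
    simp [ih.2]
    ring
end

/-! ### Cauchy–Binet and the sum of squared Vandermonde determinants -/

/-- Summing over all injective tuples is summing over all rearrangements of increasing tuples. -/
lemma sum_injective_eq_sum_strictMono {ι : Type*} [LinearOrder ι] (I : Finset ι) (a : ℕ)
    (F : (Fin a → ι) → ℚ) :
    ∑ u ∈ (Fintype.piFinset fun _ : Fin a => I) with Function.Injective u, F u =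
      ∑ s ∈ (Fintype.piFinset fun _ : Fin a => I) with StrictMono s,
        ∑ σ : Equiv.Perm (Fin a), F (s ∘ σ) := by
  classical
  rw [← Finset.sum_product']
  symm
  refine Finset.sum_bij (fun p _ => p.1 ∘ p.2) ?_ ?_ ?_ ?_
  · rintro ⟨s, σ⟩ h
    simp only [Finset.mem_product, Finset.mem_filter, Fintype.mem_piFinset, Finset.mem_univ,
      and_true] at h ⊢
    exact ⟨fun i => h.1 _, h.2.injective.comp σ.injective⟩
  · rintro ⟨s, σ⟩ h ⟨s', σ'⟩ h' he
    simp only [Finset.mem_product, Finset.mem_filter, Finset.mem_univ, and_true] at h h' he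
    have hs : s = s' := by
      rw [← StrictMono.range_inj h.2 h'.2, ← σ.surjective.range_comp s, he,
        σ'.surjective.range_comp]
    subst hs
    have : σ = σ' := by
      ext i
      exact congrArg Fin.val (h.2.injective (congrFun he i))
    rw [this]
  · intro u hu
    simp only [Finset.mem_filter, Fintype.mem_piFinset] at hu
    refine ⟨(u ∘ Tuple.sort u, (Tuple.sort u)⁻¹), ?_, ?_⟩
    · simp only [Finset.mem_product, Finset.mem_filter, Fintype.mem_piFinset, Finset.mem_univ,
        and_true]
      exact ⟨fun i => hu.1 _, (Tuple.monotone_sort u).strictMono_of_injective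
        (hu.2.comp (Tuple.sort u).injective)⟩
    · ext i; simp
  · intros; rfl

/-- The Cauchy–Binet formula, for a Gram matrix with weights. -/
lemma sum_strictMono_prod_mul_det_sq {ι : Type*} [LinearOrder ι] (I : Finset ι) (a : ℕ)
    (w : ι → ℚ) (φ : Fin a → ι → ℚ) :
    ∑ s ∈ (Fintype.piFinset fun _ : Fin a => I) with StrictMono s,
        (∏ i, w (s i)) * (Matrix.of fun i j => φ j (s i)).det ^ 2 =
      (Matrix.of fun i j => ∑ x ∈ I, w x * φ i x * φ j x).det := by
  classical
  -- The factors φ (σ i) (u i) are absorbed into the rows, and multilinearity moves the sum over `u`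
  -- inside the determinant.
  have h1 : ∀ σ : Equiv.Perm (Fin a),
      ∑ u ∈ Fintype.piFinset fun _ : Fin a => I,
        (∏ i, w (u i)) * (∏ i, φ (σ i) (u i)) * (Matrix.of fun i j => φ j (u i)).det =
      (Equiv.Perm.sign σ : ℚ) * (Matrix.of fun i j => ∑ x ∈ I, w x * φ i x * φ j x).det := by
    intro σ
    rw [← Matrix.det_permute]
    have : (Matrix.of fun i j => ∑ x ∈ I, w x * φ i x * φ j x).submatrix σ id =
        fun i => ∑ x ∈ I, (w x * φ (σ i) x) • fun j => φ j x := by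
      ext i j
      simp [Finset.sum_apply]
    rw [this]
    have := (Matrix.detRowAlternating (R := ℚ) (n := Fin a)).toMultilinearMap.map_sum_finset
      (fun i x => (w x * φ (σ i) x) • fun j => φ j x) (fun _ => I)
    refine Eq.trans ?_ this.symm
    refine Finset.sum_congr rfl fun u _ => ?_
    rw [MultilinearMap.map_smul_univ, Finset.prod_mul_distrib, smul_eq_mul]
    rfl
  -- Only one of the two determinants is expanded; its signs cancel those from the permuted Gram
  -- matrix, leaving a! equal terms.
  have h2 : ∑ u ∈ Fintype.piFinset fun _ : Fin a => I,
        (∏ i, w (u i)) * (Matrix.of fun i j => φ j (u i)).det ^ 2 =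
      (a.factorial : ℚ) * (Matrix.of fun i j => ∑ x ∈ I, w x * φ i x * φ j x).det := by
    have : ∀ u : Fin a → ι, (∏ i, w (u i)) * (Matrix.of fun i j => φ j (u i)).det ^ 2 =
        ∑ σ : Equiv.Perm (Fin a), (Equiv.Perm.sign σ : ℚ) *
          ((∏ i, w (u i)) * (∏ i, φ (σ i) (u i)) * (Matrix.of fun i j => φ j (u i)).det) := by
      intro u
      have e : (Matrix.of fun i j => φ j (u i)).det =
          ∑ σ : Equiv.Perm (Fin a), (Equiv.Perm.sign σ : ℚ) * ∏ i, φ (σ i) (u i) := by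
        rw [← Matrix.det_transpose, Matrix.det_apply']
        rfl
      rw [sq]
      nth_rewrite 1 [e]
      rw [Finset.sum_mul, Finset.mul_sum]
      exact Finset.sum_congr rfl fun σ _ => by ring
    simp only [this]
    rw [Finset.sum_comm]
    simp only [← Finset.mul_sum, h1]
    simp only [← mul_assoc]
    rw [← Finset.sum_mul]
    congr 1
    have : ∀ σ : Equiv.Perm (Fin a), ((Equiv.Perm.sign σ : ℤ) : ℚ) * ((Equiv.Perm.sign σ : ℤ) : ℚ) = 1 := by
      intro σ; rcases Int.units_eq_one_or (Equiv.Perm.sign σ) with h | h <;> simp [h]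
    simp [this, Fintype.card_perm]
  -- Tuples with a repetition give a zero determinant, and the a! rearrangements of an increasing
  -- tuple give equal summands.
  have h3 : ∑ u ∈ Fintype.piFinset fun _ : Fin a => I,
        (∏ i, w (u i)) * (Matrix.of fun i j => φ j (u i)).det ^ 2 =
      (a.factorial : ℚ) * ∑ s ∈ (Fintype.piFinset fun _ : Fin a => I) with StrictMono s,
        (∏ i, w (s i)) * (Matrix.of fun i j => φ j (s i)).det ^ 2 := by
    rw [← Finset.sum_filter_of_ne (p := Function.Injective), sum_injective_eq_sum_strictMono,
      Finset.mul_sum]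
    · refine Finset.sum_congr rfl fun s _ => ?_
      have : ∀ σ : Equiv.Perm (Fin a), (∏ i, w ((s ∘ σ) i)) *
          (Matrix.of fun i j => φ j ((s ∘ σ) i)).det ^ 2 =
          (∏ i, w (s i)) * (Matrix.of fun i j => φ j (s i)).det ^ 2 := by
        intro σ
        have e : (Matrix.of fun i j => φ j ((s ∘ σ) i)) =
          (Matrix.of fun i j => φ j (s i)).submatrix σ id := rfl
        rw [e, Matrix.det_permute, mul_pow]
        congr 1
        · exact Equiv.prod_comp σ fun i => w (s i)
        · rcases Int.units_eq_one_or (Equiv.Perm.sign σ) with h | h <;> simp [h]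
      rw [Finset.sum_congr rfl fun σ _ => this σ]
      simp [Fintype.card_perm]
    · intro u _ hu
      by_contra hinj
      apply hu
      simp only [Function.Injective, not_forall] at hinj
      obtain ⟨i, j, hij, hne⟩ := hinj
      rw [Matrix.det_zero_of_row_eq hne (by ext k; simp [hij])]
      simp
  have hf : (a.factorial : ℚ) ≠ 0 := by positivity
  exact mul_left_cancel₀ hf (h3.symm.trans h2)

/-- This is the matrix determinant lemma for a rank one perturbation, after factoring out the
diagonal matrix. -/
lemma det_diagonal_sub_vecMulVec {a : ℕ} (h v : Fin a → ℚ) (hh : ∀ i, h i ≠ 0) (t : ℚ) :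
    (Matrix.of fun i j => (if i = j then h i else 0) - t * v i * v j).det =
      (∏ i, h i) * (1 - t * ∑ i, v i ^ 2 / h i) := by
  have : (Matrix.of fun i j => (if i = j then h i else 0) - t * v i * v j) =
      Matrix.diagonal h * (1 + Matrix.replicateCol Unit (fun i => -t * v i / h i) *
        Matrix.replicateRow Unit v) := by
    ext i j
    rw [Matrix.diagonal_mul]
    simp [Matrix.mul_apply, Matrix.one_apply, mul_add]
    field_simp [hh i]
    ring
  rw [this, Matrix.det_mul, Matrix.det_diagonal, Matrix.det_one_add_replicateCol_mul_replicateRow,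
    dotProduct, Finset.mul_sum, sub_eq_add_neg, ← Finset.sum_neg_distrib]
  congr 2
  exact Finset.sum_congr rfl fun i _ => by ring

lemma gramNorm_ne_zero {n k : ℕ} (h : k < n) : gramNorm n k ≠ 0 := by
  rw [gramNorm]
  refine mul_ne_zero (by exact_mod_cast (by omega : n ≠ 0)) (Finset.prod_ne_zero_iff.2 ?_)
  intro i hi
  have hi' : i + 1 < n := by simp at hi; omega
  have h1 : ((i : ℚ) + 1) < n := by exact_mod_cast hi'
  have h0 : (0 : ℚ) ≤ i := by positivity
  rw [gramCoeff]
  push_cast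
  refine ne_of_gt (div_pos (mul_pos (by positivity) (by nlinarith)) (by nlinarith))

/-- The sum of the squared Vandermonde products over the `a`-element subsets of `n` consecutive
integers that contain the central one. -/
lemma sum_strictMono_det_vandermonde_sq (n a : ℕ) (ha : a ≤ n) (z c : ℤ)
    (hc : 2 * (c - z) + 1 = n) :
    ∑ s ∈ (Fintype.piFinset fun _ : Fin a => Finset.Ico z (z + n)) with
        StrictMono s ∧ c ∈ Set.range s, (Matrix.vandermonde fun i => (s i : ℚ)).det ^ 2 =
      (∏ k ∈ Finset.range a, gramNorm n k) *
        ∑ k ∈ Finset.range a, (gramPoly n k).eval 0 ^ 2 / gramNorm n k := by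
  classical
  set I := Finset.Ico z (z + n) with hI
  -- Translation by `c` leaves the Vandermonde determinant unchanged and places the distinguished
  -- point at 0.
  let φ : Fin a → ℤ → ℚ := fun k x => (gramPoly n k).eval ((x : ℚ) - c)
  have hdet : ∀ s : Fin a → ℤ, (Matrix.vandermonde fun i => (s i : ℚ)).det =
      (Matrix.of fun i j => φ j (s i)).det := by
    intro s
    rw [← Matrix.det_vandermonde_sub (fun i => (s i : ℚ)) c]
    exact Matrix.det_eval_matrixOfPolynomials_eq_det_vandermonde _ (fun k : Fin a => gramPoly n k)
      (fun k => (gramPoly_monic_natDegree _ _).2) (fun k => (gramPoly_monic_natDegree _ _).1)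
  have hc' : (2 * ((c : ℚ) - z) + 1) = n := by exact_mod_cast hc
  have hgram : ∀ i j : Fin a, ∑ x ∈ I, φ i x * φ j x = if i = j then gramNorm n i else 0 := by
    intro i j
    have := centredSum_gramPoly_mul_gramPoly n i j
    simp only [Fin.val_inj] at this
    rw [← this, centredSum]
    symm
    refine Finset.sum_bij (fun k _ => z + (k : ℤ)) ?_ ?_ ?_ ?_
    · intro k hk; simp only [Finset.mem_range] at hk; simp [hI, hk]
    · intro k _ l _ h; simpa using h
    · intro x hx
      simp only [hI, Finset.mem_Ico] at hx
      exact ⟨(x - z).toNat, by simp; omega, by omega⟩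
    · intro k _
      simp only [φ, Polynomial.eval_mul]
      push_cast
      rw [show (k : ℚ) - (n - 1) / 2 = z + k - c by linarith]
  have hcI : c ∈ I := by simp only [hI, Finset.mem_Ico]; omega
  -- The weight product at t = 1 is the indicator of `s` avoiding `c`, and it is 1 at t = 0; only
  -- these two values are used.
  have key : ∀ t : ℚ, ∑ s ∈ (Fintype.piFinset fun _ : Fin a => I) with StrictMono s,
      (∏ i, (1 - if s i = c then t else 0)) * (Matrix.of fun i j => φ j (s i)).det ^ 2 =
      (∏ k ∈ Finset.range a, gramNorm n k) *
        (1 - t * ∑ k ∈ Finset.range a, (gramPoly n k).eval 0 ^ 2 / gramNorm n k) := by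
    intro t
    rw [sum_strictMono_prod_mul_det_sq I a (fun x => 1 - if x = c then t else 0) φ,
      ← Fin.prod_univ_eq_prod_range (fun k => gramNorm n k),
      ← Fin.sum_univ_eq_sum_range (fun k => (gramPoly n k).eval 0 ^ 2 / gramNorm n k),
      ← det_diagonal_sub_vecMulVec (fun k : Fin a => gramNorm n k)
        (fun k : Fin a => (gramPoly n k).eval 0) (fun k => gramNorm_ne_zero (by omega)) t]
    congr 1
    ext i j
    simp only [Matrix.of_apply]
    rw [← hgram]
    have : ∀ x ∈ I, (1 - if x = c then t else 0) * φ i x * φ j x =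
        φ i x * φ j x - if x = c then t * φ i c * φ j c else 0 := by
      intro x _
      split_ifs with h
      · subst h; ring
      · ring
    rw [Finset.sum_congr rfl this, Finset.sum_sub_distrib, Finset.sum_ite_eq' I c, if_pos hcI]
    simp [φ]
  have k0 := key 0
  have k1 := key 1
  have e : (∏ k ∈ Finset.range a, gramNorm n k) *
      ∑ k ∈ Finset.range a, (gramPoly n k).eval 0 ^ 2 / gramNorm n k =
      (∏ k ∈ Finset.range a, gramNorm n k) *
        (1 - 0 * ∑ k ∈ Finset.range a, (gramPoly n k).eval 0 ^ 2 / gramNorm n k) -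
      (∏ k ∈ Finset.range a, gramNorm n k) *
        (1 - 1 * ∑ k ∈ Finset.range a, (gramPoly n k).eval 0 ^ 2 / gramNorm n k) := by ring
  rw [e, ← k0, ← k1, ← Finset.sum_sub_distrib, ← Finset.filter_filter, Finset.sum_filter]
  refine Finset.sum_congr rfl fun s _ => ?_
  rw [hdet s]
  split_ifs with h
  · obtain ⟨i, hi⟩ := h
    have : ∏ i, ((1 : ℚ) - if s i = c then 1 else 0) = 0 :=
      Finset.prod_eq_zero (Finset.mem_univ i) (by simp [hi])
    rw [this]; simp
  · have : ∀ i, s i ≠ c := fun i hi => h ⟨i, hi⟩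
    simp [this]

/-! ### Interlacing sets -/

/-- The number of elements of `S` that are at most `x`. -/
def countLE (S : Finset ℤ) (x : ℤ) : ℕ := (S.filter (· ≤ x)).card

/-- `T` interlaces `S`: between any two consecutive elements `s < s'` of `S` there is exactly one
element `t` of `T`, in the sense that `s < t ≤ s'`, and `T` has no other elements. -/
def Interlaces (T S : Finset ℤ) : Prop :=
  S.card = T.card + 1 ∧ ∀ x, countLE T x ≤ countLE S (x - 1) ∧ countLE S x ≤ countLE T x + 1

lemma countLE_image {k : ℕ} {s : Fin k → ℤ} (hs : Function.Injective s) (x : ℤ) :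
    countLE (Finset.univ.image s) x = (Finset.univ.filter fun i => s i ≤ x).card := by
  rw [countLE, Finset.filter_image, Finset.card_image_of_injective _ hs]

lemma card_filter_le_of_strictMono {k : ℕ} {s : Fin k → ℤ} (hs : StrictMono s) (i : Fin k) :
    (Finset.univ.filter fun j => s j ≤ s i).card = i + 1 := by
  simp only [hs.le_iff_le]
  rw [← Fin.card_Iic]
  congr 1
  ext; simp

/-- The counting form suits the scan of a strip of triangles, the pointwise form suits summation
over a box of tuples. They are matched by evaluating the counts at the t i and at the s i.succ. -/
lemma interlaces_image_iff {k : ℕ} {s : Fin (k + 1) → ℤ} {t : Fin k → ℤ} (hs : StrictMono s)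
    (ht : StrictMono t) :
    Interlaces (Finset.univ.image t) (Finset.univ.image s) ↔
      ∀ i, s i.castSucc < t i ∧ t i ≤ s i.succ := by
  simp only [Interlaces, countLE_image hs.injective, countLE_image ht.injective,
    Finset.card_image_of_injective _ hs.injective, Finset.card_image_of_injective _ ht.injective,
    Finset.card_univ, Fintype.card_fin, true_and]
  constructor
  · intro h i
    constructor
    · by_contra hcon
      have h1 := (h (t i)).1
      rw [card_filter_le_of_strictMono ht] at h1
      have h2 : (Finset.univ.filter fun j => s j ≤ t i - 1).card ≤ (i : ℕ) := by
        have : (Finset.univ.filter fun j => s j ≤ t i - 1) ⊆ Finset.Iio i.castSucc := by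
          intro j hj
          simp only [Finset.mem_filter, Finset.mem_univ, true_and, Finset.mem_Iio] at hj ⊢
          rw [← hs.lt_iff_lt]; omega
        simpa using Finset.card_le_card this
      omega
    · by_contra hcon
      have h1 := (h (s i.succ)).2
      rw [card_filter_le_of_strictMono hs, Fin.val_succ] at h1
      have h2 : (Finset.univ.filter fun j => t j ≤ s i.succ).card ≤ (i : ℕ) := by
        have : (Finset.univ.filter fun j => t j ≤ s i.succ) ⊆ Finset.Iio i := by
          intro j hj
          simp only [Finset.mem_filter, Finset.mem_univ, true_and, Finset.mem_Iio] at hj ⊢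
          rw [← ht.lt_iff_lt]; omega
        simpa using Finset.card_le_card this
      omega
  · intro h x
    constructor
    · rw [← Finset.card_map Fin.castSuccEmb]
      refine Finset.card_le_card fun j hj => ?_
      simp only [Finset.mem_map, Finset.mem_filter, Finset.mem_univ, true_and] at hj ⊢
      obtain ⟨i, hi, rfl⟩ := hj
      have := (h i).1
      simp only [Fin.coe_castSuccEmb]
      omega
    · rw [← Finset.card_map (Fin.succEmb k)]
      refine le_trans (Finset.card_le_card (t := Finset.map (Fin.succEmb k) _ ∪ {0}) fun j hj => ?_)
        (Finset.card_union_le _ {0})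
      simp only [Finset.mem_union, Finset.mem_map, Finset.mem_filter, Finset.mem_univ, true_and,
        Finset.mem_singleton] at hj ⊢
      rcases Fin.eq_zero_or_eq_succ j with rfl | ⟨i, rfl⟩
      · right; rfl
      · left
        exact ⟨i, (h i).2.trans hj, rfl⟩

lemma strictMono_of_mem_piFinset_Ioc {k : ℕ} {s : Fin (k + 1) → ℤ} (hs : StrictMono s)
    {t : Fin k → ℤ} (ht : ∀ i, s i.castSucc < t i ∧ t i ≤ s i.succ) : StrictMono t := by
  intro i j hij
  have h1 : s i.succ ≤ s j.castSucc := hs.monotone (by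
    rw [Fin.le_iff_val_le_val]; simp; exact hij)
  have := (ht i).2
  have := (ht j).1
  omega

/-! ### The branching rule and the number of Gelfand–Tsetlin patterns -/

section
open Polynomial

/-- Telescoping of (t)_{j+1} - (t-1)_{j+1} = (j+1) (t)_j. This makes rising factorials the
convenient monic basis for Vandermonde determinants under summation. -/
lemma sum_Ioc_ascPochhammer (j : ℕ) {x y : ℤ} (h : x ≤ y) :
    ∑ t ∈ Finset.Ioc x y, (ascPochhammer ℚ j).eval (t : ℚ) =
      ((ascPochhammer ℚ (j + 1)).eval (y : ℚ) - (ascPochhammer ℚ (j + 1)).eval (x : ℚ)) / (j + 1) := by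
  have hj : (j + 1 : ℚ) ≠ 0 := by positivity
  induction y, h using Int.leInduction with
  | base => simp
  | succ y hy ih =>
    have e : Finset.Ioc x (y + 1) = insert (y + 1) (Finset.Ioc x y) := by
      ext t; simp only [Finset.mem_Ioc, Finset.mem_insert]; omega
    rw [e, Finset.sum_insert (by simp), ih]
    have h1 : (ascPochhammer ℚ (j + 1)).eval ((y : ℚ) + 1) =
        (ascPochhammer ℚ j).eval ((y : ℚ) + 1) * (y + 1 + j) := by
      rw [ascPochhammer_succ_eval]
    have h2 : (ascPochhammer ℚ (j + 1)).eval (y : ℚ) = y * (ascPochhammer ℚ j).eval ((y : ℚ) + 1) := by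
      rw [ascPochhammer_succ_left]; simp
    push_cast
    rw [h1, h2]
    field_simp
    ring

/-- The branching rule for Vandermonde products. -/
lemma sum_det_vandermonde_interlacing {k : ℕ} {s : Fin (k + 1) → ℤ} (hs : StrictMono s) :
    (k.factorial : ℚ) * ∑ t ∈ Fintype.piFinset fun i : Fin k => Finset.Ioc (s i.castSucc) (s i.succ),
      (Matrix.vandermonde fun i => (t i : ℚ)).det = (Matrix.vandermonde fun i => (s i : ℚ)).det := by
  have hdet : ∀ (l : ℕ) (v : Fin l → ℚ), (Matrix.vandermonde v).det =
      (Matrix.of fun i j : Fin l => (ascPochhammer ℚ j).eval (v i)).det := fun l v =>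
    Matrix.det_eval_matrixOfPolynomials_eq_det_vandermonde _ (fun j : Fin l => ascPochhammer ℚ j)
      (fun j => ascPochhammer_natDegree (S := ℚ) j) (fun j => monic_ascPochhammer _ _)
  have h1 : ∑ t ∈ Fintype.piFinset fun i : Fin k => Finset.Ioc (s i.castSucc) (s i.succ),
      (Matrix.vandermonde fun i => (t i : ℚ)).det =
      (Matrix.of fun i j : Fin k => ((j : ℚ) + 1)⁻¹ * (Matrix.of fun i j : Fin k =>
        (ascPochhammer ℚ (j + 1)).eval (s i.succ : ℚ) -
          (ascPochhammer ℚ (j + 1)).eval (s i.castSucc : ℚ)) i j).det := by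
    have := (Matrix.detRowAlternating (R := ℚ) (n := Fin k)).toMultilinearMap.map_sum_finset
      (fun _ (x : ℤ) => fun j : Fin k => (ascPochhammer ℚ j).eval (x : ℚ))
      (fun i : Fin k => Finset.Ioc (s i.castSucc) (s i.succ))
    simp only [hdet]
    refine Eq.trans this.symm ?_
    change Matrix.det _ = Matrix.det _
    congr 1
    ext i j
    simp only [Finset.sum_apply, Matrix.of_apply]
    rw [sum_Ioc_ascPochhammer _ (hs.monotone (Fin.castSucc_lt_succ).le)]
    ring
  have hk : (k.factorial : ℚ) * ∏ j : Fin k, ((j : ℚ) + 1)⁻¹ = 1 := by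
    rw [Fin.prod_univ_eq_prod_range (fun j => ((j : ℚ) + 1)⁻¹), Finset.prod_inv_distrib,
      ← Finset.prod_range_add_one_eq_factorial]
    push_cast
    exact mul_inv_cancel₀ (Finset.prod_ne_zero_iff.2 fun i _ => by positivity)
  rw [h1, Matrix.det_mul_row, ← mul_assoc, hk, one_mul, hdet]
  -- Subtracting from each row its predecessor makes the first column (1, 0, …, 0); the remaining
  -- minor is the matrix of differences in `h1`.
  rw [Matrix.det_eq_of_forall_row_eq_smul_add_pred (B := Matrix.of fun i j : Fin (k + 1) =>
    Fin.cases ((ascPochhammer ℚ j).eval (s 0 : ℚ)) (fun i => (ascPochhammer ℚ j).eval (s i.succ : ℚ) -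
      (ascPochhammer ℚ j).eval (s i.castSucc : ℚ)) i) (fun _ => 1) (fun j => by simp)
      (fun i j => by simp)]
  rw [Matrix.det_succ_column_zero, Fin.sum_univ_succ]
  simp
  rfl
end

/-- The sequences `∅ = f 0, f 1, …, f k = S` of finite sets of integers each of which interlaces
the next one (prolonged by empty sets). -/
def interlacingChains (k : ℕ) (S : Finset ℤ) : Set (ℕ → Finset ℤ) :=
  {f | f 0 = ∅ ∧ f k = S ∧ (∀ j < k, Interlaces (f j) (f (j + 1))) ∧ ∀ j, k < j → f j = ∅}

lemma interlacingChains_zero : interlacingChains 0 ∅ = {fun _ => ∅} := by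
  ext f
  simp only [interlacingChains, Set.mem_ofPred_eq, Set.mem_singleton_iff]
  constructor
  · rintro ⟨h0, -, -, h⟩
    funext j
    rcases Nat.eq_zero_or_pos j with rfl | hj
    · exact h0
    · exact h j hj
  · rintro rfl; simp

/-- Deleting the last row, by resetting it to the empty set, leaves a chain ending in an increasing
tuple `t`. Interlacing confines each t i to its own interval, so these tuples form a box. -/
lemma interlacingChains_succ {k : ℕ} {s : Fin (k + 1) → ℤ} (hs : StrictMono s) :
    interlacingChains (k + 1) (Finset.univ.image s) =
      ⋃ t ∈ Fintype.piFinset fun i : Fin k => Finset.Ioc (s i.castSucc) (s i.succ),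
        (fun f => Function.update f (k + 1) (Finset.univ.image s)) ''
          interlacingChains k (Finset.univ.image t) := by
  ext f
  simp only [Set.mem_iUnion, Fintype.mem_piFinset, Finset.mem_Ioc, exists_prop, Set.mem_image]
  constructor
  · rintro ⟨h0, hS, hI, hgt⟩
    have hk := hI k (by omega)
    rw [hS] at hk
    have hcard : (f k).card = k := by
      have := hk.1
      rw [Finset.card_image_of_injective _ hs.injective] at this
      simpa using this.symm
    have ht : Finset.univ.image ((f k).orderEmbOfFin hcard) = f k :=
      Finset.image_orderEmbOfFin_univ _ _
    rw [← ht, interlaces_image_iff hs ((f k).orderEmbOfFin hcard).strictMono] at hk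
    refine ⟨_, hk, Function.update f (k + 1) ∅, ⟨?_, ?_, ?_, ?_⟩, ?_⟩
    · simp [h0]
    · simp [ht]
    · intro j hj
      rw [Function.update_of_ne (by omega), Function.update_of_ne (by omega)]
      exact hI j (by omega)
    · intro j hj
      rcases eq_or_ne j (k + 1) with rfl | hne
      · simp
      · rw [Function.update_of_ne hne]; exact hgt j (by omega)
    · rw [Function.update_idem, ← hS, Function.update_eq_self]
  · rintro ⟨t, ht, g, ⟨h0, hT, hI, hgt⟩, rfl⟩
    refine ⟨by simp [h0], by simp, fun j hj => ?_, fun j hj => ?_⟩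
    · rcases eq_or_ne j k with rfl | hne
      · rw [Function.update_self, Function.update_of_ne (by omega), hT,
          interlaces_image_iff hs (strictMono_of_mem_piFinset_Ioc hs ht)]
        exact ht
      · rw [Function.update_of_ne (by omega), Function.update_of_ne (by omega)]
        exact hI j (by omega)
    · rw [Function.update_of_ne (by omega)]
      exact hgt j (by omega)

/-- The number of interlacing chains with a given last member (Gelfand–Tsetlin patterns). -/
lemma interlacingChains_finite_ncard {k : ℕ} {s : Fin k → ℤ} (hs : StrictMono s) :
    (interlacingChains k (Finset.univ.image s)).Finite ∧
      ((interlacingChains k (Finset.univ.image s)).ncard : ℚ) *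
        ∏ i ∈ Finset.range k, (i.factorial : ℚ) = (Matrix.vandermonde fun i => (s i : ℚ)).det := by
  induction k with
  | zero =>
    have : Finset.univ.image s = ∅ := by simp
    rw [this, interlacingChains_zero]
    simp
  | succ k ih =>
    rw [interlacingChains_succ hs]
    set A := Fintype.piFinset fun i : Fin k => Finset.Ioc (s i.castSucc) (s i.succ) with hA
    have hmono : ∀ t ∈ A, StrictMono t := fun t ht =>
      strictMono_of_mem_piFinset_Ioc hs (by simpa [hA] using ht)
    have hfin : ∀ t ∈ A, ((fun f => Function.update f (k + 1) (Finset.univ.image s)) ''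
          interlacingChains k (Finset.univ.image t)).Finite := fun t ht =>
      (ih (hmono t ht)).1.image _
    refine ⟨A.finite_toSet.biUnion hfin, ?_⟩
    have hdisj : (A : Set (Fin k → ℤ)).PairwiseDisjoint fun t =>
        (fun f => Function.update f (k + 1) (Finset.univ.image s)) ''
          interlacingChains k (Finset.univ.image t) := by
      intro t ht t' ht' hne
      rw [Function.onFun, Set.disjoint_left]
      rintro _ ⟨f, hf, rfl⟩ ⟨g, hg, h⟩
      have h1 := congrFun h k
      simp only [Function.update_of_ne (show k ≠ k + 1 by omega)] at h1
      rw [hf.2.1, hg.2.1] at h1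
      apply hne
      rw [← StrictMono.range_inj (hmono t ht) (hmono t' ht')]
      simpa using congrArg (fun S : Finset ℤ => (S : Set ℤ)) h1.symm
    have hb := Set.Finite.ncard_biUnion A.finite_toSet hfin hdisj
    rw [finsum_mem_coe_finset] at hb
    simp only [Finset.mem_coe] at hb
    rw [hb]
    have hcard : ∀ t ∈ A, (((fun f => Function.update f (k + 1) (Finset.univ.image s)) ''
        interlacingChains k (Finset.univ.image t)).ncard : ℚ) *
        ∏ i ∈ Finset.range k, (i.factorial : ℚ) =
        (Matrix.vandermonde fun i => (t i : ℚ)).det := by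
      intro t ht
      rw [Set.InjOn.ncard_image, (ih (hmono t ht)).2]
      intro f hf g hg h
      funext j
      rcases eq_or_ne j (k + 1) with rfl | hne
      -- Chains are empty beyond their last index, so the overwritten value carried no information.
      · rw [hf.2.2.2 _ (by omega), hg.2.2.2 _ (by omega)]
      · simpa [Function.update_of_ne hne] using congrFun h j
    rw [Finset.prod_range_succ, mul_comm _ (k.factorial : ℚ), mul_left_comm, Nat.cast_sum,
      Finset.sum_mul, Finset.sum_congr rfl hcard, sum_det_vandermonde_interlacing hs]

/-! ### Tilings of a single strip -/

/-- Exactly one of three propositions holds. -/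
def ExactlyOne (p q r : Prop) : Prop := (p ∨ q ∨ r) ∧ ¬(p ∧ q) ∧ ¬(p ∧ r) ∧ ¬(q ∧ r)

/-- The covering condition becomes an equation between counts, usable in linear arithmetic. -/
lemma exactlyOne_iff (p q r : Prop) [Decidable p] [Decidable q] [Decidable r] : ExactlyOne p q r ↔
    (if p then 1 else 0) + (if q then 1 else 0) + (if r then 1 else 0) = 1 := by
  unfold ExactlyOne
  by_cases p <;> by_cases q <;> by_cases r <;> simp [*]

lemma countLE_eq_sub_one_add (S : Finset ℤ) (x : ℤ) :
    countLE S x = countLE S (x - 1) + if x ∈ S then 1 else 0 := by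
  have : S.filter (· ≤ x) = S.filter (· ≤ x - 1) ∪ S.filter (· = x) := by
    ext y; simp only [Finset.mem_filter, Finset.mem_union, ← and_or_left, and_congr_right_iff]
    intro _; omega
  rw [countLE, this, Finset.card_union_of_disjoint, countLE, Finset.filter_eq']
  · split_ifs <;> simp
  · rw [Finset.disjoint_left]
    intro y
    simp only [Finset.mem_filter]
    omega

lemma countLE_eq_zero {S : Finset ℤ} {x : ℤ} (h : ∀ y ∈ S, x < y) : countLE S x = 0 := by
  rw [countLE, Finset.card_eq_zero, Finset.filter_eq_empty_iff]
  intro y hy; have := h y hy; omega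

lemma countLE_eq_card {S : Finset ℤ} {x : ℤ} (h : ∀ y ∈ S, y ≤ x) : countLE S x = S.card := by
  rw [countLE, Finset.filter_true_of_mem h]

lemma countLE_le_card (S : Finset ℤ) (x : ℤ) : countLE S x ≤ S.card :=
  Finset.card_filter_le _ _

lemma countLE_mono (S : Finset ℤ) {x y : ℤ} (h : x ≤ y) : countLE S x ≤ countLE S y :=
  Finset.card_le_card (Finset.monotone_filter_right S fun _ _ h' => le_trans h' h)

/-- Moving away from the axis, a row loses one place on the left, which is how the slanting side of
the hexagon confines it. -/
lemma Interlaces.bounds {T S : Finset ℤ} (h : Interlaces T S) {lo hi : ℤ}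
    (hS : ∀ x ∈ S, lo ≤ x ∧ x ≤ hi) {x : ℤ} (hx : x ∈ T) : lo < x ∧ x ≤ hi := by
  have h1 := countLE_eq_sub_one_add T x
  rw [if_pos hx] at h1
  constructor
  · by_contra hcon
    have h2 : countLE S (x - 1) = 0 := countLE_eq_zero fun y hy => by
      have := (hS y hy).1; omega
    have := (h.2 x).1
    omega
  · by_contra hcon
    have h2 : countLE S (x - 1) = S.card := countLE_eq_card fun y hy => by
      have := (hS y hy).2; omega
    have h3 := (h.2 (x - 1)).2
    have h4 := countLE_le_card T x
    have := h.1
    omega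

/-- A strip of the triangular lattice whose boundary triangles are of the same kind, in horizontal
positions `lo, …, hi`, from which the triangles in positions `S` have been removed and from which
the triangles of the other kind in positions `T` have been removed, is tiled by the lozenges that
lean to the right in positions `R` and to the left in positions `L` exactly if `T` interlaces `S`,
and then `R` and `L` are determined. -/
lemma strip_tiled_iff {lo hi : ℤ} (h : lo ≤ hi) {T S : Finset ℤ} {R L : ℤ → Prop}
    (hT : ∀ x ∈ T, lo < x ∧ x ≤ hi) (hS : ∀ x ∈ S, lo ≤ x ∧ x ≤ hi)
    (hR : ∀ x, R x → lo < x ∧ x ≤ hi) (hL : ∀ x, L x → lo ≤ x ∧ x < hi) :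
    ((∀ x, lo < x → x ≤ hi → ExactlyOne (x ∈ T) (R x) (L (x - 1))) ∧
      (∀ x, lo ≤ x → x ≤ hi → ExactlyOne (x ∈ S) (R x) (L x))) ↔
    (Interlaces T S ∧ (∀ x, R x ↔ lo < x ∧ x ≤ hi ∧ countLE S (x - 1) = countLE T x + 1) ∧
      ∀ x, L x ↔ lo ≤ x ∧ x < hi ∧ countLE S x = countLE T x) := by
  classical
  have T0 : ∀ x, x ≤ lo → countLE T x = 0 := fun x hx => countLE_eq_zero fun y hy => by
    have := hT y hy; omega
  have S0 : ∀ x, x < lo → countLE S x = 0 := fun x hx => countLE_eq_zero fun y hy => by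
    have := hS y hy; omega
  have T1 : ∀ x, hi ≤ x → countLE T x = T.card := fun x hx => countLE_eq_card fun y hy => by
    have := hT y hy; omega
  have S1 : ∀ x, hi ≤ x → countLE S x = S.card := fun x hx => countLE_eq_card fun y hy => by
    have := hS y hy; omega
  constructor
  · rintro ⟨hu, hd⟩
    -- Among positions lo, …, x there is one boundary triangle more than triangles of the other
    -- kind. Lozenges inside this segment use one of each, so the surplus 1 is balanced by `S`, `T`
    -- and the left leaning lozenge that sticks out at `x`.
    have key : ∀ x, lo ≤ x → x ≤ hi →
        countLE T x + 1 = countLE S x + if L x then 1 else 0 := by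
      intro x hx
      induction x, hx using Int.leInduction with
      | base =>
        intro _
        have h1 := hd lo le_rfl h
        have h2 : ¬ R lo := fun hr => by have := hR _ hr; omega
        rw [countLE_eq_sub_one_add S, T0 lo le_rfl, S0 _ (by omega)]
        unfold ExactlyOne at h1
        split_ifs <;> simp_all
      | succ x hx ih =>
        intro hxh
        have ih := ih (by omega)
        have h1 := hd (x + 1) (by omega) hxh
        have h2 := hu (x + 1) (by omega) hxh
        rw [countLE_eq_sub_one_add S (x + 1), countLE_eq_sub_one_add T (x + 1)]
        rw [add_sub_cancel_right] at h2 ⊢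
        rw [exactlyOne_iff] at h1 h2
        omega
    have hcard : S.card = T.card + 1 := by
      have := key hi h le_rfl
      rw [T1 hi le_rfl, S1 hi le_rfl, if_neg (fun hl => by have := hL _ hl; omega)] at this
      omega
    have keyR : ∀ x, lo < x → x ≤ hi →
        countLE S (x - 1) = countLE T x + if R x then 1 else 0 := by
      intro x hx hxh
      have h1 := key (x - 1) (by omega) (by omega)
      have h2 := hu x hx hxh
      have h3 := countLE_eq_sub_one_add T x
      rw [exactlyOne_iff] at h2
      omega
    refine ⟨⟨hcard, fun x => ⟨?_, ?_⟩⟩, fun x => ?_, fun x => ?_⟩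
    · rcases le_or_gt x lo with hx | hx
      · rw [T0 x hx]; omega
      · rcases le_or_gt x hi with hx' | hx'
        · rw [keyR x hx hx']; omega
        · rw [T1 x (by omega), S1 (x - 1) (by omega)]; omega
    · rcases lt_or_ge x lo with hx | hx
      · rw [S0 x hx]; omega
      · rcases le_or_gt x hi with hx' | hx'
        · rw [key x hx hx']; omega
        · rw [T1 x (by omega), S1 x (by omega)]; omega
    · constructor
      · intro hr
        have := hR x hr
        refine ⟨this.1, this.2, ?_⟩
        rw [keyR x this.1 this.2, if_pos hr]
      · rintro ⟨h1, h2, h3⟩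
        have := keyR x h1 h2
        by_contra hcon
        rw [if_neg hcon] at this
        omega
    · constructor
      · intro hl
        have := hL x hl
        refine ⟨this.1, this.2, ?_⟩
        have := key x this.1 this.2.le
        rw [if_pos hl] at this
        omega
      · rintro ⟨h1, h2, h3⟩
        have := key x h1 h2.le
        by_contra hcon
        rw [if_neg hcon] at this
        omega
  · rintro ⟨⟨hcard, hI⟩, hR', hL'⟩
    refine ⟨fun x hx hxh => ?_, fun x hx hxh => ?_⟩
    · have h1 := hI x
      have h2 := hI (x - 1)
      have h3 := countLE_eq_sub_one_add T x
      simp only [ExactlyOne, hR', hL']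
      split_ifs at h3 with hm <;> simp only [hm, true_or, true_and, false_or, false_and, not_false_eq_true] <;> omega
    · have h1 := hI x
      have h2 := hI (x - 1)
      have h3 := countLE_eq_sub_one_add S x
      have h4 := T1 x
      have h5 := S1 x
      have h6 := T0 x
      have h7 := S0 (x - 1)
      have h8 := countLE_mono T (show x - 1 ≤ x by omega)
      simp only [ExactlyOne, hR', hL']
      split_ifs at h3 with hm <;> simp only [hm, true_or, true_and, false_or, false_and, not_false_eq_true] <;> omega

/-! ### The three kinds of lozenges and the covering conditions -/

/-- The lozenge formed by an upward triangle and the downward triangle to its right. -/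
def rightLozenge (x y : ℤ) : Finset UnitTriangle :=
  {UnitTriangle.up x y, UnitTriangle.down x y}

/-- The lozenge formed by a downward triangle and the upward triangle to its right. -/
def leftLozenge (x y : ℤ) : Finset UnitTriangle :=
  {UnitTriangle.down x y, UnitTriangle.up (x + 1) y}

lemma up_mem_hexagon {a b : ℕ} {x y : ℤ} : UnitTriangle.up x y ∈ hexagon a b a ↔
    0 ≤ y ∧ y + 1 ≤ 2 * a ∧ -(a : ℤ) ≤ x ∧ x + 1 ≤ b ∧ 0 ≤ x + y ∧ x + y + 1 ≤ a + b := by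
  simp only [hexagon, hexagonPoints, UnitTriangle.vertices, Set.mem_ofPred_eq, Finset.mem_insert,
    Finset.mem_singleton, forall_eq_or_imp, forall_eq]
  omega

lemma down_mem_hexagon {a b : ℕ} {x y : ℤ} : UnitTriangle.down x y ∈ hexagon a b a ↔
    0 ≤ y ∧ y + 1 ≤ 2 * a ∧ -(a : ℤ) ≤ x ∧ x + 1 ≤ b ∧ 0 ≤ x + y + 1 ∧ x + y + 2 ≤ a + b := by
  simp only [hexagon, hexagonPoints, UnitTriangle.vertices, Set.mem_ofPred_eq, Finset.mem_insert,
    Finset.mem_singleton, forall_eq_or_imp, forall_eq]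
  omega

lemma shares_side_up_down_iff {x y x' y' : ℤ} :
    ((UnitTriangle.up x y).vertices ∩ (UnitTriangle.down x' y').vertices).card = 2 ↔
      (x' = x ∧ y' = y - 1) ∨ (x' = x ∧ y' = y) ∨ (x' = x - 1 ∧ y' = y) := by
  constructor
  · intro h
    obtain ⟨p, q, hpq, he⟩ := Finset.card_eq_two.1 h
    have hp : p ∈ (UnitTriangle.up x y).vertices ∩ (UnitTriangle.down x' y').vertices := by
      simp [he]
    have hq : q ∈ (UnitTriangle.up x y).vertices ∩ (UnitTriangle.down x' y').vertices := by
      simp [he]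
    obtain ⟨p1, p2⟩ := p
    obtain ⟨q1, q2⟩ := q
    simp only [UnitTriangle.vertices, Finset.mem_inter, Finset.mem_insert, Finset.mem_singleton,
      Prod.mk.injEq, ne_eq] at hp hq hpq
    omega
  · intro h
    rw [Finset.card_eq_two]
    have aux : ∀ p q : ℤ × ℤ, p ≠ q → (∀ r, r ∈ (UnitTriangle.up x y).vertices ∩
        (UnitTriangle.down x' y').vertices ↔ r = p ∨ r = q) → ∃ p q, p ≠ q ∧
        (UnitTriangle.up x y).vertices ∩ (UnitTriangle.down x' y').vertices = {p, q} :=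
      fun p q hpq hr => ⟨p, q, hpq, by ext r; rw [hr]; simp⟩
    rcases h with ⟨rfl, rfl⟩ | ⟨rfl, rfl⟩ | ⟨rfl, rfl⟩
    · refine aux (x', y) (x' + 1, y) (by simp) ?_
      rintro ⟨r1, r2⟩
      simp only [UnitTriangle.vertices, Finset.mem_inter, Finset.mem_insert, Finset.mem_singleton,
        Prod.mk.injEq]
      omega
    · refine aux (x' + 1, y') (x', y' + 1) (by simp) ?_
      rintro ⟨r1, r2⟩
      simp only [UnitTriangle.vertices, Finset.mem_inter, Finset.mem_insert, Finset.mem_singleton,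
        Prod.mk.injEq]
      omega
    · refine aux (x, y') (x, y' + 1) (by simp) ?_
      rintro ⟨r1, r2⟩
      simp only [UnitTriangle.vertices, Finset.mem_inter, Finset.mem_insert, Finset.mem_singleton,
        Prod.mk.injEq]
      omega

/-- Two common corners force equally oriented triangles to coincide, and then they share three. -/
lemma shares_side_up_up {x y x' y' : ℤ}
    (h : ((UnitTriangle.up x y).vertices ∩ (UnitTriangle.up x' y').vertices).card = 2) : False := by
  obtain ⟨p, q, hpq, he⟩ := Finset.card_eq_two.1 h
  have hp : p ∈ (UnitTriangle.up x y).vertices ∩ (UnitTriangle.up x' y').vertices := by simp [he]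
  have hq : q ∈ (UnitTriangle.up x y).vertices ∩ (UnitTriangle.up x' y').vertices := by simp [he]
  have hxy : x = x' ∧ y = y' := by
    obtain ⟨p1, p2⟩ := p
    obtain ⟨q1, q2⟩ := q
    simp only [UnitTriangle.vertices, Finset.mem_inter, Finset.mem_insert, Finset.mem_singleton,
      Prod.mk.injEq, ne_eq] at hp hq hpq
    omega
  obtain ⟨rfl, rfl⟩ := hxy
  rw [Finset.inter_self] at h
  simp [UnitTriangle.vertices] at h

lemma shares_side_down_down {x y x' y' : ℤ}
    (h : ((UnitTriangle.down x y).vertices ∩ (UnitTriangle.down x' y').vertices).card = 2) :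
    False := by
  obtain ⟨p, q, hpq, he⟩ := Finset.card_eq_two.1 h
  have hp : p ∈ (UnitTriangle.down x y).vertices ∩ (UnitTriangle.down x' y').vertices := by simp [he]
  have hq : q ∈ (UnitTriangle.down x y).vertices ∩ (UnitTriangle.down x' y').vertices := by simp [he]
  have hxy : x = x' ∧ y = y' := by
    obtain ⟨p1, p2⟩ := p
    obtain ⟨q1, q2⟩ := q
    simp only [UnitTriangle.vertices, Finset.mem_inter, Finset.mem_insert, Finset.mem_singleton,
      Prod.mk.injEq, ne_eq] at hp hq hpq
    omega
  obtain ⟨rfl, rfl⟩ := hxy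
  rw [Finset.inter_self] at h
  simp [UnitTriangle.vertices] at h

/-- There are three kinds of lozenges. -/
lemma isLozenge_iff {ℓ : Finset UnitTriangle} : IsLozenge ℓ ↔
    ∃ x y, ℓ = verticalLozenge x y ∨ ℓ = rightLozenge x y ∨ ℓ = leftLozenge x y := by
  have ud : ∀ x y x' y', ((UnitTriangle.up x y).vertices ∩ (UnitTriangle.down x' y').vertices).card = 2 →
      ∃ u v, ({UnitTriangle.up x y, UnitTriangle.down x' y'} : Finset UnitTriangle) =
        verticalLozenge u v ∨ ({UnitTriangle.up x y, UnitTriangle.down x' y'} : Finset UnitTriangle) =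
        rightLozenge u v ∨ ({UnitTriangle.up x y, UnitTriangle.down x' y'} : Finset UnitTriangle) =
        leftLozenge u v := by
    intro x y x' y' h
    rcases shares_side_up_down_iff.1 h with ⟨rfl, rfl⟩ | ⟨rfl, rfl⟩ | ⟨rfl, rfl⟩
    · exact ⟨_, _, Or.inl rfl⟩
    · exact ⟨_, _, Or.inr (Or.inl rfl)⟩
    · refine ⟨x - 1, y', Or.inr (Or.inr ?_)⟩
      rw [leftLozenge, sub_add_cancel, Finset.pair_comm]
  constructor
  · rintro ⟨s, t, hne, hcard, rfl⟩
    rcases s with ⟨x, y⟩ | ⟨x, y⟩ <;> rcases t with ⟨x', y'⟩ | ⟨x', y'⟩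
    · exact (shares_side_up_up hcard).elim
    · exact ud _ _ _ _ hcard
    · rw [Finset.inter_comm] at hcard
      rw [Finset.pair_comm]
      exact ud _ _ _ _ hcard
    · exact (shares_side_down_down hcard).elim
  · rintro ⟨x, y, rfl | rfl | rfl⟩
    · exact ⟨_, _, by simp, shares_side_up_down_iff.2 (by simp), rfl⟩
    · exact ⟨_, _, by simp, shares_side_up_down_iff.2 (by simp), rfl⟩
    · refine ⟨_, _, ?_, ?_, rfl⟩
      · simp
      · rw [Finset.inter_comm]
        exact shares_side_up_down_iff.2 (by simp)

lemma up_mem_iff {ℓ : Finset UnitTriangle} (h : IsLozenge ℓ) (x y : ℤ) :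
    UnitTriangle.up x y ∈ ℓ ↔
      ℓ = verticalLozenge x y ∨ ℓ = rightLozenge x y ∨ ℓ = leftLozenge (x - 1) y := by
  constructor
  · obtain ⟨u, v, rfl | rfl | rfl⟩ := isLozenge_iff.1 h
    · intro hm
      simp only [verticalLozenge, Finset.mem_insert, UnitTriangle.up.injEq, Finset.mem_singleton,
        reduceCtorEq, or_false] at hm
      obtain ⟨rfl, rfl⟩ := hm
      exact Or.inl rfl
    · intro hm
      simp only [rightLozenge, Finset.mem_insert, UnitTriangle.up.injEq, Finset.mem_singleton,
        reduceCtorEq, or_false] at hm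
      obtain ⟨rfl, rfl⟩ := hm
      exact Or.inr (Or.inl rfl)
    · intro hm
      simp only [leftLozenge, Finset.mem_insert, UnitTriangle.up.injEq, Finset.mem_singleton,
        reduceCtorEq, false_or] at hm
      obtain ⟨rfl, rfl⟩ := hm
      rw [add_sub_cancel_right]
      exact Or.inr (Or.inr rfl)
  · rintro (rfl | rfl | rfl)
    · simp [verticalLozenge]
    · simp [rightLozenge]
    · simp [leftLozenge]

lemma down_mem_iff {ℓ : Finset UnitTriangle} (h : IsLozenge ℓ) (x y : ℤ) :
    UnitTriangle.down x y ∈ ℓ ↔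
      ℓ = verticalLozenge x (y + 1) ∨ ℓ = rightLozenge x y ∨ ℓ = leftLozenge x y := by
  constructor
  · obtain ⟨u, v, rfl | rfl | rfl⟩ := isLozenge_iff.1 h
    · intro hm
      simp only [verticalLozenge, Finset.mem_insert, UnitTriangle.down.injEq, Finset.mem_singleton,
        reduceCtorEq, false_or] at hm
      obtain ⟨rfl, rfl⟩ := hm
      rw [sub_add_cancel]
      exact Or.inl rfl
    · intro hm
      simp only [rightLozenge, Finset.mem_insert, UnitTriangle.down.injEq, Finset.mem_singleton,
        reduceCtorEq, false_or] at hm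
      obtain ⟨rfl, rfl⟩ := hm
      exact Or.inr (Or.inl rfl)
    · intro hm
      simp only [leftLozenge, Finset.mem_insert, UnitTriangle.down.injEq, Finset.mem_singleton,
        reduceCtorEq, or_false] at hm
      obtain ⟨rfl, rfl⟩ := hm
      exact Or.inr (Or.inr rfl)
  · rintro (rfl | rfl | rfl)
    · simp [verticalLozenge]
    · simp [rightLozenge]
    · simp [leftLozenge]

lemma verticalLozenge_ne_rightLozenge (x y u v : ℤ) : verticalLozenge x y ≠ rightLozenge u v := by
  intro h
  have h1 : UnitTriangle.up x y ∈ rightLozenge u v := h ▸ by simp [verticalLozenge]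
  have h2 : UnitTriangle.down x (y - 1) ∈ rightLozenge u v := h ▸ by simp [verticalLozenge]
  simp [rightLozenge] at h1 h2
  omega

lemma verticalLozenge_ne_leftLozenge (x y u v : ℤ) : verticalLozenge x y ≠ leftLozenge u v := by
  intro h
  have h1 : UnitTriangle.up x y ∈ leftLozenge u v := h ▸ by simp [verticalLozenge]
  have h2 : UnitTriangle.down x (y - 1) ∈ leftLozenge u v := h ▸ by simp [verticalLozenge]
  simp [leftLozenge] at h1 h2
  omega

lemma rightLozenge_ne_leftLozenge (x y u v : ℤ) : rightLozenge x y ≠ leftLozenge u v := by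
  intro h
  have h1 : UnitTriangle.up x y ∈ leftLozenge u v := h ▸ by simp [rightLozenge]
  have h2 : UnitTriangle.down x y ∈ leftLozenge u v := h ▸ by simp [rightLozenge]
  simp [leftLozenge] at h1 h2
  omega

lemma verticalLozenge_inj {x y u v : ℤ} (h : verticalLozenge x y = verticalLozenge u v) :
    x = u ∧ y = v := by
  have h1 : UnitTriangle.up x y ∈ verticalLozenge u v := h ▸ by simp [verticalLozenge]
  simpa [verticalLozenge] using h1

lemma rightLozenge_inj {x y u v : ℤ} (h : rightLozenge x y = rightLozenge u v) :
    x = u ∧ y = v := by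
  have h1 : UnitTriangle.up x y ∈ rightLozenge u v := h ▸ by simp [rightLozenge]
  simpa [rightLozenge] using h1

lemma leftLozenge_inj {x y u v : ℤ} (h : leftLozenge x y = leftLozenge u v) :
    x = u ∧ y = v := by
  have h1 : UnitTriangle.down x y ∈ leftLozenge u v := h ▸ by simp [leftLozenge]
  simpa [leftLozenge] using h1

lemma existsUnique_mem_iff_exactlyOne {α : Type*} {T : Finset α} {A B C : α} (hAB : A ≠ B)
    (hAC : A ≠ C) (hBC : B ≠ C) :
    (∃! ℓ, ℓ ∈ T ∧ (ℓ = A ∨ ℓ = B ∨ ℓ = C)) ↔ ExactlyOne (A ∈ T) (B ∈ T) (C ∈ T) := by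
  constructor
  · rintro ⟨ℓ, ⟨hT, h⟩, hu⟩
    have hA : A ∈ T → A = ℓ := fun h => hu A ⟨h, Or.inl rfl⟩
    have hB : B ∈ T → B = ℓ := fun h => hu B ⟨h, Or.inr (Or.inl rfl)⟩
    have hC : C ∈ T → C = ℓ := fun h => hu C ⟨h, Or.inr (Or.inr rfl)⟩
    refine ⟨?_, fun h => hAB ((hA h.1).trans (hB h.2).symm),
      fun h => hAC ((hA h.1).trans (hC h.2).symm), fun h => hBC ((hB h.1).trans (hC h.2).symm)⟩
    rcases h with rfl | rfl | rfl <;> simp [hT]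
  · rintro ⟨h | h | h, hab, hac, hbc⟩
    · refine ⟨A, ⟨h, Or.inl rfl⟩, ?_⟩
      rintro ℓ ⟨hT, rfl | rfl | rfl⟩
      exacts [rfl, (hab ⟨h, hT⟩).elim, (hac ⟨h, hT⟩).elim]
    · refine ⟨B, ⟨h, Or.inr (Or.inl rfl)⟩, ?_⟩
      rintro ℓ ⟨hT, rfl | rfl | rfl⟩
      exacts [(hab ⟨hT, h⟩).elim, rfl, (hbc ⟨h, hT⟩).elim]
    · refine ⟨C, ⟨h, Or.inr (Or.inr rfl)⟩, ?_⟩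
      rintro ℓ ⟨hT, rfl | rfl | rfl⟩
      exacts [(hac ⟨hT, h⟩).elim, (hbc ⟨hT, h⟩).elim, rfl]

/-- A set of lozenges is a tiling if each triangle is covered by exactly one of the three lozenges
that contain it. -/
lemma isLozengeTiling_iff {R : Set UnitTriangle} {T : Finset (Finset UnitTriangle)}
    (hT : ∀ ℓ ∈ T, IsLozenge ℓ ∧ (ℓ : Set UnitTriangle) ⊆ R) :
    IsLozengeTiling R T ↔
      (∀ x y, UnitTriangle.up x y ∈ R → ExactlyOne (verticalLozenge x y ∈ T)
        (rightLozenge x y ∈ T) (leftLozenge (x - 1) y ∈ T)) ∧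
      (∀ x y, UnitTriangle.down x y ∈ R → ExactlyOne (verticalLozenge x (y + 1) ∈ T)
        (rightLozenge x y ∈ T) (leftLozenge x y ∈ T)) := by
  have hu : ∀ x y, (∃! ℓ, ℓ ∈ T ∧ UnitTriangle.up x y ∈ ℓ) ↔ ExactlyOne (verticalLozenge x y ∈ T)
        (rightLozenge x y ∈ T) (leftLozenge (x - 1) y ∈ T) := by
    intro x y
    rw [← existsUnique_mem_iff_exactlyOne (verticalLozenge_ne_rightLozenge _ _ _ _)
      (verticalLozenge_ne_leftLozenge _ _ _ _) (rightLozenge_ne_leftLozenge _ _ _ _)]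
    exact existsUnique_congr fun ℓ => and_congr_right fun h => up_mem_iff (hT ℓ h).1 x y
  have hd : ∀ x y, (∃! ℓ, ℓ ∈ T ∧ UnitTriangle.down x y ∈ ℓ) ↔
      ExactlyOne (verticalLozenge x (y + 1) ∈ T)
        (rightLozenge x y ∈ T) (leftLozenge x y ∈ T) := by
    intro x y
    rw [← existsUnique_mem_iff_exactlyOne (verticalLozenge_ne_rightLozenge _ _ _ _)
      (verticalLozenge_ne_leftLozenge _ _ _ _) (rightLozenge_ne_leftLozenge _ _ _ _)]
    exact existsUnique_congr fun ℓ => and_congr_right fun h => down_mem_iff (hT ℓ h).1 x y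
  simp only [← hu, ← hd]
  constructor
  · exact fun h => ⟨fun x y => h.2 _, fun x y => h.2 _⟩
  · refine fun h => ⟨hT, fun t ht => ?_⟩
    rcases t with ⟨x, y⟩ | ⟨x, y⟩
    exacts [h.1 x y ht, h.2 x y ht]

/-! ### The hexagon as two stacks of strips -/

open Classical in
/-- The positions of the vertical lozenges on the horizontal line at height `j ≤ a`. -/
noncomputable def lowerRow (a b : ℕ) (T : Finset (Finset UnitTriangle)) (j : ℕ) : Finset ℤ :=
  if j ≤ a then (Finset.Icc (-(a : ℤ)) b).filter fun x => verticalLozenge x j ∈ T else ∅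

open Classical in
/-- The positions of the vertical lozenges on the horizontal line at depth `j ≤ a` below the top
side, moved to the right by `a - j`. -/
noncomputable def upperRow (a b : ℕ) (T : Finset (Finset UnitTriangle)) (j : ℕ) : Finset ℤ :=
  if j ≤ a then (Finset.Icc (-(a : ℤ)) b).filter
    fun x => verticalLozenge (x - (a - j)) (2 * a - j) ∈ T else ∅

/-- `f` records the vertical lozenges, and `R` and `L` the two other kinds of lozenges in the strips
of a half of the hexagon, and each triangle is covered by exactly one lozenge. -/
def HalfTiled (a b : ℕ) (f : ℕ → Finset ℤ) (R L : ℕ → ℤ → Prop) : Prop :=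
  ∀ j < a, (∀ x : ℤ, -((j : ℤ) + 1) < x → x ≤ (b : ℤ) - 1 →
      ExactlyOne (x ∈ f j) (R j x) (L j (x - 1))) ∧
    (∀ x : ℤ, -((j : ℤ) + 1) ≤ x → x ≤ (b : ℤ) - 1 → ExactlyOne (x ∈ f (j + 1)) (R j x) (L j x))

/-- The places that the right leaning lozenges of a strip have to take. -/
def IsRightPlace (b : ℕ) (f : ℕ → Finset ℤ) (j : ℕ) (x : ℤ) : Prop :=
  -((j : ℤ) + 1) < x ∧ x ≤ (b : ℤ) - 1 ∧ countLE (f (j + 1)) (x - 1) = countLE (f j) x + 1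

/-- The places that the left leaning lozenges of a strip have to take. -/
def IsLeftPlace (b : ℕ) (f : ℕ → Finset ℤ) (j : ℕ) (x : ℤ) : Prop :=
  -((j : ℤ) + 1) ≤ x ∧ x < (b : ℤ) - 1 ∧ countLE (f (j + 1)) x = countLE (f j) x

lemma halfTiled_iff {a b : ℕ} {f : ℕ → Finset ℤ} {R L : ℕ → ℤ → Prop}
    (hf0 : f 0 = ∅) (hf : ∀ j < a, ∀ x ∈ f (j + 1), -((j : ℤ) + 1) ≤ x ∧ x ≤ (b : ℤ) - 1)
    (hR : ∀ j < a, ∀ x, R j x → -((j : ℤ) + 1) < x ∧ x ≤ (b : ℤ) - 1)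
    (hL : ∀ j < a, ∀ x, L j x → -((j : ℤ) + 1) ≤ x ∧ x < (b : ℤ) - 1) :
    HalfTiled a b f R L ↔ ∀ j < a, Interlaces (f j) (f (j + 1)) ∧
      (∀ x, R j x ↔ IsRightPlace b f j x) ∧ (∀ x, L j x ↔ IsLeftPlace b f j x) := by
  refine forall₂_congr fun j hj => ?_
  refine strip_tiled_iff (by omega) ?_ (hf j hj) (hR j hj) (hL j hj)
  rcases j with _ | j
  · simp [hf0]
  · intro x hx
    have := hf j (by omega) x hx
    push_cast
    omega

section
variable {a b : ℕ} {T : Finset (Finset UnitTriangle)}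

lemma vertical_bounds (hT : ∀ ℓ ∈ T, IsLozenge ℓ ∧ (ℓ : Set UnitTriangle) ⊆ hexagon a b a)
    {x y : ℤ} (h : verticalLozenge x y ∈ T) :
    UnitTriangle.up x y ∈ hexagon a b a ∧ UnitTriangle.down x (y - 1) ∈ hexagon a b a :=
  ⟨(hT _ h).2 (by simp [verticalLozenge]), (hT _ h).2 (by simp [verticalLozenge])⟩

lemma right_bounds (hT : ∀ ℓ ∈ T, IsLozenge ℓ ∧ (ℓ : Set UnitTriangle) ⊆ hexagon a b a)
    {x y : ℤ} (h : rightLozenge x y ∈ T) :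
    UnitTriangle.up x y ∈ hexagon a b a ∧ UnitTriangle.down x y ∈ hexagon a b a :=
  ⟨(hT _ h).2 (by simp [rightLozenge]), (hT _ h).2 (by simp [rightLozenge])⟩

lemma left_bounds (hT : ∀ ℓ ∈ T, IsLozenge ℓ ∧ (ℓ : Set UnitTriangle) ⊆ hexagon a b a)
    {x y : ℤ} (h : leftLozenge x y ∈ T) :
    UnitTriangle.up (x + 1) y ∈ hexagon a b a ∧ UnitTriangle.down x y ∈ hexagon a b a :=
  ⟨(hT _ h).2 (by simp [leftLozenge]), (hT _ h).2 (by simp [leftLozenge])⟩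

lemma mem_lowerRow (hT : ∀ ℓ ∈ T, IsLozenge ℓ ∧ (ℓ : Set UnitTriangle) ⊆ hexagon a b a)
    {j : ℕ} {x : ℤ} : x ∈ lowerRow a b T j ↔ j ≤ a ∧ verticalLozenge x j ∈ T := by
  unfold lowerRow
  split_ifs with h
  · simp only [Finset.mem_filter, Finset.mem_Icc, h, true_and, and_iff_right_iff_imp]
    intro hv
    have := up_mem_hexagon.1 (vertical_bounds hT hv).1
    omega
  · simp [h]

lemma mem_upperRow (hT : ∀ ℓ ∈ T, IsLozenge ℓ ∧ (ℓ : Set UnitTriangle) ⊆ hexagon a b a)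
    {j : ℕ} {x : ℤ} : x ∈ upperRow a b T j ↔
      j ≤ a ∧ verticalLozenge (x - (a - j)) (2 * a - j) ∈ T := by
  unfold upperRow
  split_ifs with h
  · simp only [Finset.mem_filter, Finset.mem_Icc, h, true_and, and_iff_right_iff_imp]
    intro hv
    have := up_mem_hexagon.1 (vertical_bounds hT hv).1
    omega
  · simp [h]

lemma ExactlyOne.swap {p q r : Prop} : ExactlyOne p q r ↔ ExactlyOne p r q := by
  unfold ExactlyOne; tauto

/-- The lozenges tile the hexagon if they tile both halves. -/
lemma isLozengeTiling_hexagon_iff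
    (hT : ∀ ℓ ∈ T, IsLozenge ℓ ∧ (ℓ : Set UnitTriangle) ⊆ hexagon a b a) :
    IsLozengeTiling (hexagon a b a) T ↔
      HalfTiled a b (lowerRow a b T) (fun j x => rightLozenge x j ∈ T)
        (fun j x => leftLozenge x j ∈ T) ∧
      HalfTiled a b (upperRow a b T)
        (fun j x => leftLozenge (x - (a - j)) (2 * a - 1 - j) ∈ T)
        (fun j x => rightLozenge (x - (a - 1 - j)) (2 * a - 1 - j) ∈ T) := by
  rw [isLozengeTiling_iff hT]
  simp only [HalfTiled, mem_lowerRow hT, mem_upperRow hT]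
  constructor
  · rintro ⟨hu, hd⟩
    refine ⟨fun j hj => ⟨fun x h1 h2 => ?_, fun x h1 h2 => ?_⟩,
      fun j hj => ⟨fun x h1 h2 => ?_, fun x h1 h2 => ?_⟩⟩
    · simpa [hj.le] using hu x j (up_mem_hexagon.2 (by omega))
    · simpa [Nat.succ_le_of_lt hj] using hd x j (down_mem_hexagon.2 (by omega))
    -- The upper half is the mirror image of the lower one in the horizontal axis; in lattice
    -- coordinates, height j goes to 2a - j with the horizontal shift a - j. Reflection exchanges
    -- upward with downward triangles and right with left leaning lozenges, whence the swap.
    · have := ExactlyOne.swap.1 (hd (x - (a - j)) (2 * a - 1 - j) (down_mem_hexagon.2 (by omega)))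
      rw [show (2 * a - 1 - j + 1 : ℤ) = 2 * a - j by ring] at this
      rw [show x - 1 - ((a : ℤ) - 1 - j) = x - (a - j) by ring]
      simpa [hj.le] using this
    · have := ExactlyOne.swap.1 (hu (x - (a - 1 - j)) (2 * a - 1 - j) (up_mem_hexagon.2 (by omega)))
      rw [show x - ((a : ℤ) - 1 - j) - 1 = x - (a - j) by ring] at this
      push_cast
      rw [show x - ((a : ℤ) - (j + 1)) = x - (a - 1 - j) by ring,
        show (2 * a - (j + 1) : ℤ) = 2 * a - 1 - j by ring]
      simpa [Nat.succ_le_of_lt hj] using this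
  · rintro ⟨hl, hu⟩
    refine ⟨fun x y h => ?_, fun x y h => ?_⟩
    · rw [up_mem_hexagon] at h
      rcases lt_or_ge y a with hy | hy
      · obtain ⟨j, rfl⟩ := Int.eq_ofNat_of_zero_le h.1
        have hj : j < a := by omega
        simpa [hj.le] using (hl j hj).1 x (by omega) (by omega)
      · obtain ⟨j, hj⟩ := Int.eq_ofNat_of_zero_le (show 0 ≤ 2 * (a : ℤ) - 1 - y by omega)
        obtain rfl : y = 2 * a - 1 - j := by omega
        have hj : j < a := by omega
        have := ExactlyOne.swap.1 ((hu j hj).2 (x + (a - 1 - j)) (by omega) (by omega))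
        push_cast at this
        rw [show x + ((a : ℤ) - 1 - j) - (a - (j + 1)) = x by ring,
          show x + ((a : ℤ) - 1 - j) - (a - j) = x - 1 by ring,
          show x + ((a : ℤ) - 1 - j) - (a - 1 - j) = x by ring,
          show (2 * a - (j + 1) : ℤ) = 2 * a - 1 - j by ring] at this
        simpa [Nat.succ_le_of_lt hj] using this
    · rw [down_mem_hexagon] at h
      rcases lt_or_ge y a with hy | hy
      · obtain ⟨j, rfl⟩ := Int.eq_ofNat_of_zero_le h.1
        have hj : j < a := by omega
        simpa [Nat.succ_le_of_lt hj] using (hl j hj).2 x (by omega) (by omega)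
      · obtain ⟨j, hj⟩ := Int.eq_ofNat_of_zero_le (show 0 ≤ 2 * (a : ℤ) - 1 - y by omega)
        obtain rfl : y = 2 * a - 1 - j := by omega
        have hj : j < a := by omega
        have := ExactlyOne.swap.1 ((hu j hj).1 (x + (a - j)) (by omega) (by omega))
        rw [show x + ((a : ℤ) - j) - (a - j) = x by ring,
          show x + ((a : ℤ) - j) - 1 - (a - 1 - j) = x by ring,
          show (2 * a - j : ℤ) = 2 * a - 1 - j + 1 by ring] at this
        simpa [hj.le] using this

lemma lowerRow_zero (hT : ∀ ℓ ∈ T, IsLozenge ℓ ∧ (ℓ : Set UnitTriangle) ⊆ hexagon a b a) :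
    lowerRow a b T 0 = ∅ := by
  refine Finset.eq_empty_of_forall_notMem fun x hx => ?_
  have := down_mem_hexagon.1 (vertical_bounds hT ((mem_lowerRow hT).1 hx).2).2
  omega

lemma upperRow_zero (hT : ∀ ℓ ∈ T, IsLozenge ℓ ∧ (ℓ : Set UnitTriangle) ⊆ hexagon a b a) :
    upperRow a b T 0 = ∅ := by
  refine Finset.eq_empty_of_forall_notMem fun x hx => ?_
  have := up_mem_hexagon.1 (vertical_bounds hT ((mem_upperRow hT).1 hx).2).1
  omega

/-- A set of lozenges in the hexagon is a tiling if the rows of vertical lozenges in both halves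
interlace, and the other lozenges are in the places that are determined by these rows. -/
lemma isLozengeTiling_hexagon_iff_interlaces
    (hT : ∀ ℓ ∈ T, IsLozenge ℓ ∧ (ℓ : Set UnitTriangle) ⊆ hexagon a b a) :
    IsLozengeTiling (hexagon a b a) T ↔
      (∀ j < a, Interlaces (lowerRow a b T j) (lowerRow a b T (j + 1)) ∧
        (∀ x, rightLozenge x j ∈ T ↔ IsRightPlace b (lowerRow a b T) j x) ∧
        (∀ x, leftLozenge x j ∈ T ↔ IsLeftPlace b (lowerRow a b T) j x)) ∧
      (∀ j < a, Interlaces (upperRow a b T j) (upperRow a b T (j + 1)) ∧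
        (∀ x, leftLozenge (x - (a - j)) (2 * a - 1 - j) ∈ T ↔
          IsRightPlace b (upperRow a b T) j x) ∧
        (∀ x, rightLozenge (x - (a - 1 - j)) (2 * a - 1 - j) ∈ T ↔
          IsLeftPlace b (upperRow a b T) j x)) := by
  rw [isLozengeTiling_hexagon_iff hT, halfTiled_iff (lowerRow_zero hT),
    halfTiled_iff (upperRow_zero hT)]
  · intro j hj x hx
    have := up_mem_hexagon.1 (vertical_bounds hT ((mem_upperRow hT).1 hx).2).1
    push_cast at this
    omega
  · intro j hj x hx
    have h1 := up_mem_hexagon.1 (left_bounds hT hx).1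
    have h2 := down_mem_hexagon.1 (left_bounds hT hx).2
    omega
  · intro j hj x hx
    have h1 := up_mem_hexagon.1 (right_bounds hT hx).1
    have h2 := down_mem_hexagon.1 (right_bounds hT hx).2
    omega
  · intro j hj x hx
    have := down_mem_hexagon.1 (vertical_bounds hT ((mem_lowerRow hT).1 hx).2).2
    push_cast at this
    omega
  · intro j hj x hx
    have h1 := up_mem_hexagon.1 (right_bounds hT hx).1
    have h2 := down_mem_hexagon.1 (right_bounds hT hx).2
    omega
  · intro j hj x hx
    have h1 := up_mem_hexagon.1 (left_bounds hT hx).1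
    have h2 := down_mem_hexagon.1 (left_bounds hT hx).2
    omega
end

/-! ### Tilings correspond to pairs of interlacing chains -/

lemma interlacingChains_bounds {k : ℕ} {S : Finset ℤ} {f : ℕ → Finset ℤ}
    (hf : f ∈ interlacingChains k S) {b : ℕ} (hS : ∀ x ∈ S, -(k : ℤ) ≤ x ∧ x ≤ (b : ℤ) - 1)
    {j : ℕ} (hj : j ≤ k) : ∀ x ∈ f j, -(j : ℤ) ≤ x ∧ x ≤ (b : ℤ) - 1 := by
  induction hj using Nat.decreasingInduction with
  | self => rw [hf.2.1]; exact hS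
  | of_succ j hj ih =>
    intro x hx
    have := (hf.2.2.1 j hj).bounds ih hx
    push_cast at this
    omega

/-- The pairs of interlacing chains with a common last member that consists of integers in
`[-a, b - 1]`, one of which is `c`. -/
def chainPairs (a b : ℕ) (c : ℤ) : Set ((ℕ → Finset ℤ) × (ℕ → Finset ℤ)) :=
  {p | ∃ S : Finset ℤ, (∀ x ∈ S, -(a : ℤ) ≤ x ∧ x ≤ (b : ℤ) - 1) ∧ c ∈ S ∧
    p.1 ∈ interlacingChains a S ∧ p.2 ∈ interlacingChains a S}

section
variable {a b : ℕ}

lemma lowerRow_last_eq_upperRow_last {T : Finset (Finset UnitTriangle)}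
    (hT : ∀ ℓ ∈ T, IsLozenge ℓ ∧ (ℓ : Set UnitTriangle) ⊆ hexagon a b a) :
    lowerRow a b T a = upperRow a b T a := by
  ext x
  rw [mem_lowerRow hT, mem_upperRow hT, sub_self, sub_zero,
    show (2 * a - a : ℤ) = a by ring]

lemma rows_mem_chainPairs {T : Finset (Finset UnitTriangle)}
    (hT : IsLozengeTiling (hexagon a b a) T) {c : ℤ} (hc : verticalLozenge c a ∈ T) :
    (lowerRow a b T, upperRow a b T) ∈ chainPairs a b c := by
  have h := (isLozengeTiling_hexagon_iff_interlaces hT.1).1 hT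
  refine ⟨lowerRow a b T a, fun x hx => ?_, (mem_lowerRow hT.1).2 ⟨le_rfl, hc⟩,
    ⟨lowerRow_zero hT.1, rfl, fun j hj => (h.1 j hj).1, fun j hj => ?_⟩,
    ⟨upperRow_zero hT.1, (lowerRow_last_eq_upperRow_last hT.1).symm, fun j hj => (h.2 j hj).1,
      fun j hj => ?_⟩⟩
  · have := down_mem_hexagon.1 (vertical_bounds hT.1 ((mem_lowerRow hT.1).1 hx).2).2
    omega
  · exact if_neg (by omega)
  · exact if_neg (by omega)

/-- The rows list the vertical lozenges and force the places of all others, so they determine the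
tiling; applied both ways, this gives injectivity. -/
lemma tiling_subset_of_rows_eq {T T' : Finset (Finset UnitTriangle)}
    (hT : IsLozengeTiling (hexagon a b a) T) (hT' : IsLozengeTiling (hexagon a b a) T')
    (hl : lowerRow a b T = lowerRow a b T') (hu : upperRow a b T = upperRow a b T') : T ⊆ T' := by
  have h := (isLozengeTiling_hexagon_iff_interlaces hT.1).1 hT
  have h' := (isLozengeTiling_hexagon_iff_interlaces hT'.1).1 hT'
  intro ℓ hℓ
  obtain ⟨x, y, rfl | rfl | rfl⟩ := isLozenge_iff.1 (hT.1 ℓ hℓ).1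
  · have hb := vertical_bounds hT.1 hℓ
    rw [up_mem_hexagon, down_mem_hexagon] at hb
    rcases le_or_gt y a with hy | hy
    · obtain ⟨j, rfl⟩ := Int.eq_ofNat_of_zero_le hb.1.1
      have : x ∈ lowerRow a b T j := (mem_lowerRow hT.1).2 ⟨by omega, hℓ⟩
      rw [hl, mem_lowerRow hT'.1] at this
      exact this.2
    · obtain ⟨j, hj⟩ := Int.eq_ofNat_of_zero_le (show 0 ≤ 2 * (a : ℤ) - y by omega)
      obtain rfl : y = 2 * a - j := by omega
      have : x + (a - j) ∈ upperRow a b T j :=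
        (mem_upperRow hT.1).2 ⟨by omega, by rwa [add_sub_cancel_right]⟩
      rw [hu, mem_upperRow hT'.1, add_sub_cancel_right] at this
      exact this.2
  · have hb := right_bounds hT.1 hℓ
    rw [up_mem_hexagon, down_mem_hexagon] at hb
    rcases lt_or_ge y a with hy | hy
    · obtain ⟨j, rfl⟩ := Int.eq_ofNat_of_zero_le hb.1.1
      exact ((h'.1 j (by omega)).2.1 x).2 (hl ▸ ((h.1 j (by omega)).2.1 x).1 hℓ)
    · obtain ⟨j, hj⟩ := Int.eq_ofNat_of_zero_le (show 0 ≤ 2 * (a : ℤ) - 1 - y by omega)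
      obtain rfl : y = 2 * a - 1 - j := by omega
      have e := (h.2 j (by omega)).2.2 (x + (a - 1 - j))
      have e' := (h'.2 j (by omega)).2.2 (x + (a - 1 - j))
      rw [add_sub_cancel_right] at e e'
      exact e'.2 (hu ▸ e.1 hℓ)
  · have hb := left_bounds hT.1 hℓ
    rw [up_mem_hexagon, down_mem_hexagon] at hb
    rcases lt_or_ge y a with hy | hy
    · obtain ⟨j, rfl⟩ := Int.eq_ofNat_of_zero_le hb.1.1
      exact ((h'.1 j (by omega)).2.2 x).2 (hl ▸ ((h.1 j (by omega)).2.2 x).1 hℓ)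
    · obtain ⟨j, hj⟩ := Int.eq_ofNat_of_zero_le (show 0 ≤ 2 * (a : ℤ) - 1 - y by omega)
      obtain rfl : y = 2 * a - 1 - j := by omega
      have e := (h.2 j (by omega)).2.1 (x + (a - j))
      have e' := (h'.2 j (by omega)).2.1 (x + (a - j))
      rw [add_sub_cancel_right] at e e'
      exact e'.2 (hu ▸ e.1 hℓ)

/-- Every pair of interlacing chains with a common last member comes from a tiling. -/
lemma exists_tiling_of_chains {S : Finset ℤ} (hS : ∀ x ∈ S, -(a : ℤ) ≤ x ∧ x ≤ (b : ℤ) - 1)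
    {f g : ℕ → Finset ℤ} (hf : f ∈ interlacingChains a S) (hg : g ∈ interlacingChains a S) :
    ∃ T, IsLozengeTiling (hexagon a b a) T ∧ lowerRow a b T = f ∧ upperRow a b T = g := by
  classical
  have bf : ∀ j ≤ a, ∀ x ∈ f j, -(j : ℤ) ≤ x ∧ x ≤ (b : ℤ) - 1 := fun j hj =>
    interlacingChains_bounds hf hS hj
  have bg : ∀ j ≤ a, ∀ x ∈ g j, -(j : ℤ) ≤ x ∧ x ≤ (b : ℤ) - 1 := fun j hj =>
    interlacingChains_bounds hg hS hj
  -- On the axis y = a both alternatives apply, with j = a; they agree because both chains end in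
  -- `S`.
  let V : ℤ → ℤ → Prop := fun x y => (∃ j : ℕ, j ≤ a ∧ y = j ∧ x ∈ f j) ∨
    ∃ j : ℕ, j ≤ a ∧ y = 2 * a - j ∧ x + (a - j) ∈ g j
  let R : ℤ → ℤ → Prop := fun x y => (∃ j : ℕ, j < a ∧ y = j ∧ IsRightPlace b f j x) ∨
    ∃ j : ℕ, j < a ∧ y = 2 * a - 1 - j ∧ IsLeftPlace b g j (x + (a - 1 - j))
  let L : ℤ → ℤ → Prop := fun x y => (∃ j : ℕ, j < a ∧ y = j ∧ IsLeftPlace b f j x) ∨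
    ∃ j : ℕ, j < a ∧ y = 2 * a - 1 - j ∧ IsRightPlace b g j (x + (a - j))
  let T : Finset (Finset UnitTriangle) := (hexagon_finite a b a).toFinset.powerset.filter fun ℓ =>
    (∃ x y, ℓ = verticalLozenge x y ∧ V x y) ∨ (∃ x y, ℓ = rightLozenge x y ∧ R x y) ∨
      ∃ x y, ℓ = leftLozenge x y ∧ L x y
  have memT : ∀ ℓ, ℓ ∈ T ↔ (ℓ : Set UnitTriangle) ⊆ hexagon a b a ∧
      ((∃ x y, ℓ = verticalLozenge x y ∧ V x y) ∨ (∃ x y, ℓ = rightLozenge x y ∧ R x y) ∨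
      ∃ x y, ℓ = leftLozenge x y ∧ L x y) := by
    intro ℓ
    simp only [T, Finset.mem_filter, Finset.mem_powerset, ← Finset.coe_subset,
      Set.Finite.coe_toFinset]
  have hT : ∀ ℓ ∈ T, IsLozenge ℓ ∧ (ℓ : Set UnitTriangle) ⊆ hexagon a b a := by
    intro ℓ hℓ
    obtain ⟨h1, ⟨x, y, h, -⟩ | ⟨x, y, h, -⟩ | ⟨x, y, h, -⟩⟩ := (memT ℓ).1 hℓ
    · exact ⟨isLozenge_iff.2 ⟨x, y, Or.inl h⟩, h1⟩
    · exact ⟨isLozenge_iff.2 ⟨x, y, Or.inr (Or.inl h)⟩, h1⟩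
    · exact ⟨isLozenge_iff.2 ⟨x, y, Or.inr (Or.inr h)⟩, h1⟩
  have sub : ∀ s t : UnitTriangle, s ∈ hexagon a b a → t ∈ hexagon a b a →
      ((({s, t} : Finset UnitTriangle) : Set UnitTriangle) ⊆ hexagon a b a) := by
    intro s t hs ht u hu
    simp only [Finset.coe_insert, Finset.coe_singleton, Set.mem_insert_iff,
      Set.mem_singleton_iff] at hu
    rcases hu with rfl | rfl <;> assumption
  have hV : ∀ x y, verticalLozenge x y ∈ T ↔ V x y := by
    intro x y
    rw [memT]
    constructor
    · rintro ⟨-, ⟨u, v, h, hV⟩ | ⟨u, v, h, -⟩ | ⟨u, v, h, -⟩⟩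
      · obtain ⟨rfl, rfl⟩ := verticalLozenge_inj h; exact hV
      · exact (verticalLozenge_ne_rightLozenge _ _ _ _ h).elim
      · exact (verticalLozenge_ne_leftLozenge _ _ _ _ h).elim
    · intro h
      refine ⟨?_, Or.inl ⟨x, y, rfl, h⟩⟩
      rcases h with ⟨j, hj, rfl, hx⟩ | ⟨j, hj, rfl, hx⟩
      -- A vertical lozenge on the bottom side would stick out of the hexagon; row 0 is empty.
      · have h0 : j ≠ 0 := by rintro rfl; simp [hf.1] at hx
        have := bf j hj x hx
        exact sub _ _ (up_mem_hexagon.2 (by omega)) (down_mem_hexagon.2 (by omega))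
      · have h0 : j ≠ 0 := by rintro rfl; simp [hg.1] at hx
        have := bg j hj _ hx
        exact sub _ _ (up_mem_hexagon.2 (by omega)) (down_mem_hexagon.2 (by omega))
  have hR : ∀ x y, rightLozenge x y ∈ T ↔ R x y := by
    intro x y
    rw [memT]
    constructor
    · rintro ⟨-, ⟨u, v, h, -⟩ | ⟨u, v, h, hR⟩ | ⟨u, v, h, -⟩⟩
      · exact (verticalLozenge_ne_rightLozenge _ _ _ _ h.symm).elim
      · obtain ⟨rfl, rfl⟩ := rightLozenge_inj h; exact hR
      · exact (rightLozenge_ne_leftLozenge _ _ _ _ h).elim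
    · intro h
      refine ⟨?_, Or.inr (Or.inl ⟨x, y, rfl, h⟩)⟩
      rcases h with ⟨j, hj, rfl, h1, h2, -⟩ | ⟨j, hj, rfl, h1, h2, -⟩
      · exact sub _ _ (up_mem_hexagon.2 (by omega)) (down_mem_hexagon.2 (by omega))
      · exact sub _ _ (up_mem_hexagon.2 (by omega)) (down_mem_hexagon.2 (by omega))
  have hL : ∀ x y, leftLozenge x y ∈ T ↔ L x y := by
    intro x y
    rw [memT]
    constructor
    · rintro ⟨-, ⟨u, v, h, -⟩ | ⟨u, v, h, -⟩ | ⟨u, v, h, hL⟩⟩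
      · exact (verticalLozenge_ne_leftLozenge _ _ _ _ h.symm).elim
      · exact (rightLozenge_ne_leftLozenge _ _ _ _ h.symm).elim
      · obtain ⟨rfl, rfl⟩ := leftLozenge_inj h; exact hL
    · intro h
      refine ⟨?_, Or.inr (Or.inr ⟨x, y, rfl, h⟩)⟩
      rcases h with ⟨j, hj, rfl, h1, h2, -⟩ | ⟨j, hj, rfl, h1, h2, -⟩
      · exact sub _ _ (down_mem_hexagon.2 (by omega)) (up_mem_hexagon.2 (by omega))
      · exact sub _ _ (down_mem_hexagon.2 (by omega)) (up_mem_hexagon.2 (by omega))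
  have hl : lowerRow a b T = f := by
    funext j
    ext x
    rw [mem_lowerRow hT, hV]
    constructor
    · rintro ⟨hj, ⟨i, hi, hij, hx⟩ | ⟨i, hi, hij, hx⟩⟩
      · obtain rfl : i = j := by omega
        exact hx
      · obtain rfl : i = a := by omega
        obtain rfl : j = i := by omega
        rw [sub_self, add_zero] at hx
        rwa [hf.2.1, ← hg.2.1]
    · intro hx
      have hj : j ≤ a := by
        by_contra hcon
        rw [hf.2.2.2 j (by omega)] at hx
        simp at hx
      exact ⟨hj, Or.inl ⟨j, hj, rfl, hx⟩⟩
  have hu : upperRow a b T = g := by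
    funext j
    ext x
    rw [mem_upperRow hT, hV]
    constructor
    · rintro ⟨hj, ⟨i, hi, hij, hx⟩ | ⟨i, hi, hij, hx⟩⟩
      · obtain rfl : i = a := by omega
        obtain rfl : j = i := by omega
        rw [sub_self, sub_zero] at hx
        rwa [hg.2.1, ← hf.2.1]
      · obtain rfl : i = j := by omega
        rwa [sub_add_cancel] at hx
    · intro hx
      have hj : j ≤ a := by
        by_contra hcon
        rw [hg.2.2.2 j (by omega)] at hx
        simp at hx
      exact ⟨hj, Or.inr ⟨j, hj, rfl, by rwa [sub_add_cancel]⟩⟩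
  refine ⟨T, (isLozengeTiling_hexagon_iff_interlaces hT).2 ?_, hl, hu⟩
  rw [hl, hu]
  refine ⟨fun j hj => ⟨hf.2.2.1 j hj, fun x => ?_, fun x => ?_⟩,
    fun j hj => ⟨hg.2.2.1 j hj, fun x => ?_, fun x => ?_⟩⟩
  · rw [hR]
    constructor
    · rintro (⟨i, hi, hij, h⟩ | ⟨i, hi, hij, h⟩)
      · obtain rfl : i = j := by omega
        exact h
      · omega
    · exact fun h => Or.inl ⟨j, hj, rfl, h⟩
  · rw [hL]
    constructor
    · rintro (⟨i, hi, hij, h⟩ | ⟨i, hi, hij, h⟩)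
      · obtain rfl : i = j := by omega
        exact h
      · omega
    · exact fun h => Or.inl ⟨j, hj, rfl, h⟩
  · rw [hL]
    constructor
    · rintro (⟨i, hi, hij, h⟩ | ⟨i, hi, hij, h⟩)
      · omega
      · obtain rfl : i = j := by omega
        rwa [sub_add_cancel] at h
    · exact fun h => Or.inr ⟨j, hj, rfl, by rwa [sub_add_cancel]⟩
  · rw [hR]
    constructor
    · rintro (⟨i, hi, hij, h⟩ | ⟨i, hi, hij, h⟩)
      · omega
      · obtain rfl : i = j := by omega
        rwa [sub_add_cancel] at h
    · exact fun h => Or.inr ⟨j, hj, rfl, by rwa [sub_add_cancel]⟩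

lemma centralTilings_ncard_eq_chainPairs {c : ℤ} (hc : 2 * c + 1 = (b : ℤ) - a) :
    (centralTilings a b a).ncard = (chainPairs a b c).ncard := by
  have hcen : ∀ T, HasCentralVerticalLozenge a b a T ↔ verticalLozenge c a ∈ T := by
    intro T
    constructor
    · rintro ⟨x, y, hx, hy, h⟩
      obtain rfl : x = c := by omega
      obtain rfl : y = a := by omega
      exact h
    · exact fun h => ⟨c, a, hc, by ring, h⟩
  refine Set.ncard_congr (fun T _ => (lowerRow a b T, upperRow a b T)) ?_ ?_ ?_
  · exact fun T hT => rows_mem_chainPairs hT.1 ((hcen T).1 hT.2)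
  · intro T T' hT hT' h
    rw [Prod.mk.injEq] at h
    exact (tiling_subset_of_rows_eq hT.1 hT'.1 h.1 h.2).antisymm
      (tiling_subset_of_rows_eq hT'.1 hT.1 h.1.symm h.2.symm)
  · rintro ⟨f, g⟩ ⟨S, hS, hcS, hf, hg⟩
    obtain ⟨T, hT, hl, hu⟩ := exists_tiling_of_chains hS hf hg
    refine ⟨T, ⟨hT, (hcen T).2 ?_⟩, by rw [hl, hu]⟩
    have : c ∈ lowerRow a b T a := by rw [hl, hf.2.1]; exact hcS
    exact ((mem_lowerRow hT.1).1 this).2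

/-- The pairs split according to their common last row, and each half contributes one Vandermonde
factor. The interval is written as -a + (a + b) to fit the form z + n of the Vandermonde sum. -/
lemma chainPairs_ncard (c : ℤ) :
    ((chainPairs a b c).ncard : ℚ) * (∏ i ∈ Finset.range a, (i.factorial : ℚ)) ^ 2 =
      ∑ s ∈ (Fintype.piFinset fun _ : Fin a =>
        Finset.Ico (-(a : ℤ)) (-(a : ℤ) + ((a + b : ℕ) : ℤ))) with
        StrictMono s ∧ c ∈ Set.range s, (Matrix.vandermonde fun i => (s i : ℚ)).det ^ 2 := by
  set A := (Fintype.piFinset fun _ : Fin a =>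
        Finset.Ico (-(a : ℤ)) (-(a : ℤ) + ((a + b : ℕ) : ℤ))).filter
        fun s => StrictMono s ∧ c ∈ Set.range s with hA
  have memA : ∀ s, s ∈ A ↔ (∀ i, -(a : ℤ) ≤ s i ∧ s i ≤ (b : ℤ) - 1) ∧ StrictMono s ∧
      c ∈ Set.range s := by
    intro s
    simp only [hA, Finset.mem_filter, Fintype.mem_piFinset, Finset.mem_Ico]
    refine and_congr_left' (forall_congr' fun i => ?_)
    push_cast
    omega
  let P : (Fin a → ℤ) → Set ((ℕ → Finset ℤ) × (ℕ → Finset ℤ)) := fun s =>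
    interlacingChains a (Finset.univ.image s) ×ˢ interlacingChains a (Finset.univ.image s)
  have hP : chainPairs a b c = ⋃ s ∈ (A : Set (Fin a → ℤ)), P s := by
    ext ⟨f, g⟩
    simp only [Set.mem_iUnion, exists_prop, Finset.mem_coe, memA]
    constructor
    · rintro ⟨S, hS, hcS, hf, hg⟩
      dsimp only at hf hg
      have hcard : S.card = a := by
        -- Each interlacing step adds one element, so the common last row has `a` elements.
        have : ∀ j ≤ a, (f j).card = j := by
          intro j
          induction j with
          | zero => intro _; rw [hf.1]; rfl
          | succ j ih => intro hj; rw [(hf.2.2.1 j (by omega)).1, ih (by omega)]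
        rw [← hf.2.1]; exact this a le_rfl
      have him : Finset.univ.image (S.orderEmbOfFin hcard) = S :=
        Finset.image_orderEmbOfFin_univ _ _
      refine ⟨S.orderEmbOfFin hcard, ⟨fun i => hS _ (Finset.orderEmbOfFin_mem _ _ _),
        (S.orderEmbOfFin hcard).strictMono, ?_⟩, ?_⟩
      · rw [Finset.range_orderEmbOfFin]; exact hcS
      · simp only [P, him]
        exact ⟨hf, hg⟩
    · rintro ⟨s, ⟨hs, -, hcs⟩, hf, hg⟩
      exact ⟨Finset.univ.image s, by simpa using hs, by simpa using hcs, hf, hg⟩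
  have hfin : ∀ s ∈ (A : Set (Fin a → ℤ)), (P s).Finite := fun s hs =>
    (interlacingChains_finite_ncard ((memA s).1 hs).2.1).1.prod
      (interlacingChains_finite_ncard ((memA s).1 hs).2.1).1
  have hdisj : (A : Set (Fin a → ℤ)).PairwiseDisjoint P := by
    intro s hs s' hs' hne
    rw [Function.onFun, Set.disjoint_left]
    rintro ⟨f, g⟩ h h'
    apply hne
    rw [← StrictMono.range_inj ((memA s).1 hs).2.1 ((memA s').1 hs').2.1]
    simpa using congrArg (fun S : Finset ℤ => (S : Set ℤ)) (h.1.2.1.symm.trans h'.1.2.1)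
  rw [hP, Set.Finite.ncard_biUnion A.finite_toSet hfin hdisj, finsum_mem_coe_finset, Nat.cast_sum,
    Finset.sum_mul]
  refine Finset.sum_congr rfl fun s hs => ?_
  rw [← (interlacingChains_finite_ncard ((memA s).1 hs).2.1).2, Set.ncard_prod]
  push_cast
  ring
end

/-! ### Evaluation of the norms and of the central values -/

/-- For n = 0 the truncated subtraction gives superfactorial 0, that is 1, in accordance with V_{-1}
= 1. -/
lemma superFactorial_pred_eq_prod (n : ℕ) :
    (Nat.superFactorial (n - 1) : ℚ) = ∏ i ∈ Finset.range n, (i.factorial : ℚ) := by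
  rcases n with _ | n
  · simp
  · induction n with
    | zero => simp
    | succ n ih =>
      rw [Finset.prod_range_succ, ← ih]
      simp only [Nat.add_sub_cancel, Nat.superFactorial_succ]
      push_cast
      ring

lemma gramNorm_succ (n k : ℕ) : gramNorm n (k + 1) = gramNorm n k * gramCoeff n (k + 1) := by
  rw [gramNorm, gramNorm, Finset.prod_range_succ, mul_assoc]

lemma gramNorm_eq_factorials {n k : ℕ} (h : k < n) :
    gramNorm n k = (k.factorial : ℚ) ^ 4 * (n + k).factorial /
      ((2 * k).factorial * (2 * k + 1).factorial * (n - k - 1).factorial) := by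
  induction k with
  | zero =>
    obtain ⟨n, rfl⟩ := Nat.exists_eq_succ_of_ne_zero (by omega : n ≠ 0)
    have : (n.factorial : ℚ) ≠ 0 := by positivity
    simp [gramNorm, Nat.factorial_succ]
    field_simp
  | succ k ih =>
    obtain ⟨d, rfl⟩ := Nat.exists_eq_add_of_lt h
    rw [gramNorm_succ, ih (by omega), gramCoeff,
      show k + 1 + d + 1 - k - 1 = d + 1 by omega, show k + 1 + d + 1 - (k + 1) - 1 = d by omega,
      show 2 * (k + 1) = 2 * k + 1 + 1 by ring, show k + 1 + d + 1 + (k + 1) = k + 1 + d + 1 + k + 1 by ring]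
    simp only [Nat.factorial_succ]
    have h1 : (d.factorial : ℚ) ≠ 0 := by positivity
    have h2 : ((2 * k).factorial : ℚ) ≠ 0 := by positivity
    have h3 : (4 * (((k + 1 : ℕ) : ℚ)) ^ 2 - 1) = (2 * k + 1) * (2 * k + 3) := by push_cast; ring
    rw [h3]
    push_cast
    field_simp
    ring

lemma prod_gramNorm {n a : ℕ} (h : a ≤ n) :
    (∏ k ∈ Finset.range a, gramNorm n k) =
      (∏ i ∈ Finset.range a, (i.factorial : ℚ)) ^ 4 *
        (∏ i ∈ Finset.range (n + a), (i.factorial : ℚ)) *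
        (∏ i ∈ Finset.range (n - a), (i.factorial : ℚ)) /
      ((∏ i ∈ Finset.range n, (i.factorial : ℚ)) ^ 2 *
        ∏ i ∈ Finset.range (2 * a), (i.factorial : ℚ)) := by
  have hF : ∀ l : ℕ, (∏ i ∈ Finset.range l, (i.factorial : ℚ)) ≠ 0 := fun l =>
    Finset.prod_ne_zero_iff.2 fun i _ => by positivity
  induction a with
  | zero =>
    have := hF n
    simp
    field_simp
  | succ a ih =>
    rw [Finset.prod_range_succ, ih (by omega), gramNorm_eq_factorials (by omega)]
    obtain ⟨d, rfl⟩ := Nat.exists_eq_add_of_lt (show a < n by omega)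
    rw [show a + d + 1 - a = d + 1 by omega, show a + d + 1 - (a + 1) = d by omega,
      show d + 1 - 1 = d by omega,
      show 2 * (a + 1) = 2 * a + 1 + 1 by ring, show a + d + 1 + (a + 1) = a + d + 1 + a + 1 by ring,
      Finset.prod_range_succ _ d, Finset.prod_range_succ _ (a + d + 1 + a),
      Finset.prod_range_succ _ (2 * a + 1), Finset.prod_range_succ _ (2 * a),
      Finset.prod_range_succ _ a]
    have h1 : (d.factorial : ℚ) ≠ 0 := by positivity
    have h2 : ((2 * a).factorial : ℚ) ≠ 0 := by positivity
    have h3 : ((2 * a + 1).factorial : ℚ) ≠ 0 := by positivity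
    have h4 := hF (2 * a)
    have h5 := hF (a + d + 1)
    field_simp

lemma risingFactorial_succ (x : ℚ) (j : ℕ) :
    risingFactorial x (j + 1) = risingFactorial x j * (x + j) := ascPochhammer_succ_eval _ _

/-- Writing γ_k for `gramCoeff N k`, the quotient of the terms for j + 1 and j is γ_{2j+1} /
γ_{2j+2}. For N = 2M - 1 the factors N² - k² split into the linear factors involving M, and (5/4)_j
/ (1/4)_j comes from the denominators 4k² - 1. -/
lemma gramPoly_sq_div_gramNorm {N M : ℕ} (hN : N + 1 = 2 * M) {j : ℕ} (hj : 2 * j < N) :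
    (gramPoly N (2 * j)).eval 0 ^ 2 / gramNorm N (2 * j) =
      1 / N * ((risingFactorial (1 / 2) j ^ 2 * risingFactorial (5 / 4) j *
        risingFactorial (1 - M) j * risingFactorial M j) /
      (risingFactorial 1 j ^ 2 * risingFactorial (1 / 4) j *
        risingFactorial (1 / 2 + M) j * risingFactorial (3 / 2 - M) j)) := by
  induction j with
  | zero => simp [gramPoly, gramNorm, risingFactorial]
  | succ j ih =>
    have hN' : (N : ℚ) = 2 * M - 1 := by
      have : (N : ℚ) + 1 = 2 * M := by exact_mod_cast hN
      linarith
    have hM : (j : ℚ) + 2 ≤ M := by exact_mod_cast (by omega : j + 2 ≤ M)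
    have e1 : (gramPoly N (2 * (j + 1))).eval 0 = -gramCoeff N (2 * j + 1) *
        (gramPoly N (2 * j)).eval 0 := by
      rw [(gramPoly_eval_zero _ _).1, (gramPoly_eval_zero _ _).1, Finset.prod_range_succ, mul_comm]
    have e2 : gramNorm N (2 * (j + 1)) =
        gramNorm N (2 * j) * (gramCoeff N (2 * j + 1) * gramCoeff N (2 * j + 2)) := by
      rw [show 2 * (j + 1) = 2 * j + 1 + 1 by ring, gramNorm_succ, gramNorm_succ, mul_assoc]
    have n1 : (j : ℚ) + 1 - M ≠ 0 := by linarith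
    have n2 : (3 : ℚ) / 2 - M + j ≠ 0 := by linarith
    have n3 : (1 : ℚ) / 2 + M + j ≠ 0 := by positivity
    have n4 : (M : ℚ) + j ≠ 0 := by linarith [show (0 : ℚ) ≤ j by positivity]
    have g1 : gramCoeff N (2 * j + 1) =
        -(2 * j + 1) ^ 2 * ((1 - M + j) * (M + j)) / ((4 * j + 1) * (4 * j + 3)) := by
      rw [gramCoeff, hN']
      push_cast
      rw [show (4 * (2 * (j : ℚ) + 1) ^ 2 - 1) = (4 * j + 1) * (4 * j + 3) by ring]
      field_simp
      ring
    have g2 : gramCoeff N (2 * j + 2) =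
        -(2 * j + 2) ^ 2 * ((3 / 2 - M + j) * (1 / 2 + M + j)) / ((4 * j + 3) * (4 * j + 5)) := by
      rw [gramCoeff, hN']
      push_cast
      rw [show (4 * (2 * (j : ℚ) + 2) ^ 2 - 1) = (4 * j + 3) * (4 * j + 5) by ring]
      field_simp
      ring
    have n5 : (1 : ℚ) - M + j ≠ 0 := by linarith
    have ratio : (-gramCoeff N (2 * j + 1)) ^ 2 / (gramCoeff N (2 * j + 1) * gramCoeff N (2 * j + 2)) =
        ((1 / 2 + j) ^ 2 * (5 / 4 + j) * (1 - M + j) * (M + j)) /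
          ((1 + j) ^ 2 * (1 / 4 + j) * (1 / 2 + M + j) * (3 / 2 - M + j)) := by
      rw [g1, g2]
      have n6 : (1 : ℚ) + j ≠ 0 := by positivity
      have n7 : (1 : ℚ) / 4 + j ≠ 0 := by positivity
      rw [show (2 * (j : ℚ) + 2) = 2 * (1 + j) by ring, show (2 * (j : ℚ) + 1) = 2 * (1 / 2 + j) by ring,
        show (4 * (j : ℚ) + 1) = 4 * (1 / 4 + j) by ring, show (4 * (j : ℚ) + 5) = 4 * (5 / 4 + j) by ring]
      generalize (1 : ℚ) - M + j = A at *
      generalize (M : ℚ) + j = B at *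
      generalize (3 : ℚ) / 2 - M + j = D at *
      generalize (1 : ℚ) / 2 + M + j = E at *
      have n8 : (1 : ℚ) / 2 + j ≠ 0 := by positivity
      have n9 : (5 : ℚ) / 4 + j ≠ 0 := by positivity
      have n10 : (4 : ℚ) * j + 3 ≠ 0 := by positivity
      generalize (1 : ℚ) / 2 + j = F at *
      generalize (5 : ℚ) / 4 + j = G at *
      generalize (4 : ℚ) * j + 3 = H at *
      generalize (1 : ℚ) + j = I at *
      generalize (1 : ℚ) / 4 + j = J at *
      field_simp
    rw [e1, e2, mul_pow, mul_comm _ (Polynomial.eval _ _ ^ 2), mul_div_mul_comm, ih (by omega), ratio,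
      mul_assoc, ← mul_div_mul_comm]
    simp only [risingFactorial_succ]
    congr 2 <;> ring

/-- Terms of odd degree vanish by parity. The ranges for a = 2m - 1 and a = 2m differ only by the
index 2m - 1, so one sum serves both parts of the theorem. -/
lemma sum_range_gramPoly {m n a : ℕ} (ha : a ≤ 2 * m + 2 * n - 1) (h : a + 1 = 2 * m ∨ a = 2 * m) :
    ∑ k ∈ Finset.range a, (gramPoly (2 * m + 2 * n - 1 : ℕ) k).eval 0 ^ 2 /
      gramNorm (2 * m + 2 * n - 1) k =
    1 / ((2 * m + 2 * n - 1 : ℕ) : ℚ) * wellPoisedSum m n := by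
  have hodd : ∀ l : ℕ, ∑ k ∈ Finset.range (2 * l), (gramPoly (2 * m + 2 * n - 1 : ℕ) k).eval 0 ^ 2 /
      gramNorm (2 * m + 2 * n - 1) k =
      ∑ j ∈ Finset.range l, (gramPoly (2 * m + 2 * n - 1 : ℕ) (2 * j)).eval 0 ^ 2 /
      gramNorm (2 * m + 2 * n - 1) (2 * j) := by
    intro l
    induction l with
    | zero => simp
    | succ l ih =>
      rw [show 2 * (l + 1) = 2 * l + 1 + 1 by ring, Finset.sum_range_succ, Finset.sum_range_succ,
        Finset.sum_range_succ _ l, ih, (gramPoly_eval_zero _ l).2]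
      simp
  have hsum : ∑ k ∈ Finset.range a, (gramPoly (2 * m + 2 * n - 1 : ℕ) k).eval 0 ^ 2 /
      gramNorm (2 * m + 2 * n - 1) k =
      ∑ k ∈ Finset.range (2 * m), (gramPoly (2 * m + 2 * n - 1 : ℕ) k).eval 0 ^ 2 /
      gramNorm (2 * m + 2 * n - 1) k := by
    rcases h with h | rfl
    · obtain ⟨l, rfl⟩ : ∃ l, m = l + 1 := ⟨m - 1, by omega⟩
      obtain rfl : a = 2 * l + 1 := by omega
      rw [show 2 * (l + 1) = 2 * l + 1 + 1 by ring, Finset.sum_range_succ _ (2 * l + 1),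
        (gramPoly_eval_zero _ l).2]
      simp
    · rfl
  rw [hsum, hodd, wellPoisedSum, Finset.mul_sum]
  refine Finset.sum_congr rfl fun j hj => ?_
  rw [Finset.mem_range] at hj
  rw [gramPoly_sq_div_gramNorm (M := m + n) (by omega) (by omega)]
  push_cast
  rw [← sub_sub, ← sub_sub, ← add_assoc]

/-- Let F_l be the product of i! over i < l. The norms multiply to F_a⁴ F_{2a+b} F_b / (F_{a+b}²
F_{2a}), the two halves divide by F_a², and the remaining factor 1 / (a + b) is the term j = 0 of
the sum. -/
lemma centralTilings_ncard {m n a b : ℕ} (h : a + 1 = 2 * m ∨ a = 2 * m)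
    (hab : a + b = 2 * m + 2 * n - 1) {c : ℤ} (hc : 2 * c + 1 = (b : ℤ) - a) :
    ((centralTilings a b a).ncard : ℚ) =
      (Nat.superFactorial (a + b + a - 1) * Nat.superFactorial (b - 1) *
          Nat.superFactorial (a - 1) ^ 2 : ℚ) /
        (((a + b : ℕ) : ℚ) * Nat.superFactorial (a + b - 1) ^ 2 * Nat.superFactorial (2 * a - 1)) *
      wellPoisedSum m n := by
  have h1 := chainPairs_ncard (a := a) (b := b) c
  rw [← centralTilings_ncard_eq_chainPairs hc, sum_strictMono_det_vandermonde_sq (a + b) a (by omega)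
    (-a) c (by push_cast; omega), prod_gramNorm (by omega)] at h1
  have h2 := sum_range_gramPoly (m := m) (n := n) (a := a) (by omega) h
  rw [← hab] at h2
  rw [h2, show a + b - a = b by omega] at h1
  simp only [superFactorial_pred_eq_prod]
  have hF : ∀ l : ℕ, (∏ i ∈ Finset.range l, (i.factorial : ℚ)) ≠ 0 := fun l =>
    Finset.prod_ne_zero_iff.2 fun i _ => by positivity
  have hFa := pow_ne_zero 2 (hF a)
  apply mul_right_cancel₀ hFa
  rw [h1]
  ring

theorem mainTheorem4 :
    (∀ m n : ℕ, 1 ≤ m →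
      ((centralTilings (2 * m - 1) (2 * n) (2 * m - 1)).ncard : ℚ) =
        (Nat.superFactorial (4 * m + 2 * n - 3) * Nat.superFactorial (2 * n - 1) *
            Nat.superFactorial (2 * m - 2) ^ 2 : ℚ) /
          ((2 * m + 2 * n - 1 : ℚ) * Nat.superFactorial (2 * m + 2 * n - 2) ^ 2 *
            Nat.superFactorial (4 * m - 3)) *
        wellPoisedSum m n) ∧
    (∀ m n : ℕ, 1 ≤ n →
      ((centralTilings (2 * m) (2 * n - 1) (2 * m)).ncard : ℚ) =
        (Nat.superFactorial (4 * m + 2 * n - 2) * Nat.superFactorial (2 * n - 2) *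
            Nat.superFactorial (2 * m - 1) ^ 2 : ℚ) /
          ((2 * m + 2 * n - 1 : ℚ) * Nat.superFactorial (2 * m + 2 * n - 2) ^ 2 *
            Nat.superFactorial (4 * m - 1)) *
        wellPoisedSum m n) := by
  have hN : ∀ m n N : ℕ, N + 1 = 2 * m + 2 * n → (N : ℚ) = 2 * m + 2 * n - 1 := by
    intro m n N h
    have : (N : ℚ) + 1 = 2 * m + 2 * n := by exact_mod_cast h
    linarith
  refine ⟨fun m n hm => ?_, fun m n hn => ?_⟩
  -- The value of `c` solves 2c + 1 = b - a; it is an integer because a and b have opposite parity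
  -- in both parts.
  · rw [centralTilings_ncard (m := m) (n := n) (c := (n : ℤ) - m) (by omega) (by omega) (by omega),
      hN m n (2 * m - 1 + 2 * n) (by omega), show 2 * m - 1 + 2 * n + (2 * m - 1) - 1 = 4 * m + 2 * n - 3 by omega,
      show 2 * m - 1 - 1 = 2 * m - 2 by omega,
      show 2 * m - 1 + 2 * n - 1 = 2 * m + 2 * n - 2 by omega,
      show 2 * (2 * m - 1) - 1 = 4 * m - 3 by omega]
  · rw [centralTilings_ncard (m := m) (n := n) (c := (n : ℤ) - m - 1) (by omega) (by omega) (by omega),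
      hN m n (2 * m + (2 * n - 1)) (by omega), show 2 * m + (2 * n - 1) + 2 * m - 1 = 4 * m + 2 * n - 2 by omega,
      show 2 * n - 1 - 1 = 2 * n - 2 by omega,
      show 2 * m + (2 * n - 1) - 1 = 2 * m + 2 * n - 2 by omega,
      show 2 * (2 * m) - 1 = 4 * m - 1 by omega]
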